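/- **Setting.** Let $1\le n\le K$, let $\ell_1\ge\dots\ge\ell_K>0$, and let $V$ be a random vector in $\mathbb R^n$ with distribution $\mathsf P$ and $\mathbb E\|V\|^2<\infty$. Put $\mu=\mathbb E[V]$ and $\Sigma^*=\operatorname{var}(V)$, and assume $\Sigma^*\neq0$. A triple $(c,(d_i)_{i=1}^K,f)$ with $c,d_i\in\mathbb R^n$ and $f:\mathbb R^n\to\mathbb R^K$ measurable is *feasible* if $\langle d_i,d_i\rangle=\ell_i$ for all $i$, $\operatorname{span}(d_i)\supset\operatorname{supp}\mathsf P-c$, and $V-c=\sum_i f_i(V)\,d_i$ almost surely. Its cost is $\mathbb E_{\mathsf P}\|f(V)\|^2$, and the $\ell_2$-optimal dictionary problem is to minimize the cost over all feasible triples. **Algorithm.** Input: a symmetric positive semidefinite matrix $\Sigma'\ne0$ of rank $m$, and $(\ell_i)_{i=1}^K$. 1. Compute the nonzero eigenvalues $\sigma_1\ge\dots\ge\sigma_m>0$ of $\Sigma'$, with multiplicity, and corresponding orthonormal eigenvectors $u_1,\dots,u_m$. 2. Put $\ell_i'=\ell_i$ for $i<m$ and $\ell_m'=\sum_{j=m}^K\ell_j$.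 Let $\varphi$ minimize $\sum_{t=1}^m(\ell_t'\varphi_t^2-2\sqrt{\sigma_t}\,\varphi_t)$ subject to $0\le\varphi_1\le\dots\le\varphi_m$. Cut $\{1,\dots,m\}$ into consecutive blocks, a new block starting at $1$ and at each $t$ with $\varphi_{t-1}<\varphi_t$. For $i$ in a block $B$ put $\lambda_i=\sqrt{\sigma_i}\,\sum_{j\in B}\ell'_j\big/\sum_{j\in B}\sqrt{\sigma_j}$. 3. Put $M=\sum_{i=1}^m\lambda_iu_iu_i^\top$. Let $\kappa_1\ge\dots\ge\kappa_r>0$ be its nonzero eigenvalues with orthonormal eigenvectors $w_1,\dots,w_r$, let $C=(\sqrt{\kappa_1}w_1\ \cdots\ \sqrt{\kappa_r}w_r\ 0\ \cdots\ 0)\in\mathbb R^{n\times K}$ and $\Lambda=\operatorname{diag}(\kappa_1,\dots,\kappa_r,0,\dots,0)\in\mathbb R^{K\times K}$. Output $d_i=Cx_i$, where $x_1,\dots,x_K$ are computed as follows. Let $q(x)=\langle x,\Lambda x\rangle$, and start with an orthonormal list $v_1,\dots,v_K$ of eigenvectors of $\Lambda$, sorted so that $q$ is non-increasing along it. For $t=1,\dots,K$,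 with the current list $v_1,v_2,\dots$ and $a=\ell_t$: - if $q(v_1)=a$, put $x_t=v_1$ and delete $v_1$ from the list; - if $q(v_1)>a$, choose $i>1$ with $q(v_i)\le a<q(v_{i-1})$, put $\Theta=\frac{\sqrt{a-q(v_i)}}{\sqrt{a-q(v_i)}+\sqrt{q(v_1)-a}}$ and $\rho=\sqrt{\Theta^2+(1-\Theta)^2}$, put $x_t=\rho^{-1}(\Theta v_1+(1-\Theta)v_i)$, and replace $v_1,v_i$ in the list by the single vector $\rho^{-1}((1-\Theta)v_1-\Theta v_i)$; and re-sort the list so that $q$ is again non-increasing along it. The algorithm leaves choices open (eigenvectors, order of ties). Let $D(\mu',\Sigma')=(d_1'\ \cdots\ d_K')$ denote the output for an arbitrary way of making the choices, which may differ for different $(\mu',\Sigma')$. With the constant of representation $\mu'$, the corresponding scheme is $f'(v)=D(\mu',\Sigma')^+(v-\mu')$, where $^+$ is the Moore–Penrose pseudo-inverse. Its cost is $J(\mu',\Sigma')=\mathbb E_{\mathsf P}\|f'(V)\|^2$. **Proposition.** The algorithm has an output for every symmetric positive semidefinite $\Sigma'\neq0$. For every way of making the choices: - $J(\mu',\Sigma')\to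 J(\mu,\Sigma^*)$ as $\mu'\to\mu$ and $\Sigma'\to\Sigma^*$, where $\mu'$ ranges over $\mathbb R^n$ and $\Sigma'$ over the symmetric positive semidefinite matrices with $\operatorname{rank}\Sigma'=\operatorname{rank}\Sigma^*$; - $J(\mu,\Sigma^*)$ is finite and is the optimal cost: $\mu$, the dictionary $D(\mu,\Sigma^*)$ and its scheme $v\mapsto D(\mu,\Sigma^*)^+(v-\mu)$ form a feasible triple whose cost is minimal among all feasible triples. -/

import Mathlib

open Filter Topology MeasureTheory

namespace L2Dict

noncomputable section

/-! ## Moore–Penrose pseudo-inverse of a real matrix -/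

/-- The four Penrose conditions: `X` is the Moore–Penrose pseudo-inverse of `A`. -/
structure IsMoorePenrose {p q : ℕ} (A : Matrix (Fin p) (Fin q) ℝ)
    (X : Matrix (Fin q) (Fin p) ℝ) : Prop where
  mul_mul : A * X * A = A
  mul_mul' : X * A * X = X
  symm : (A * X).transpose = A * X
  symm' : (X * A).transpose = X * A

theorem exists_isMoorePenrose {p q : ℕ} (A : Matrix (Fin p) (Fin q) ℝ) :
    ∃ X, IsMoorePenrose A X := by
  obtain ⟨H, hH, h1, h2, h3⟩ : ∃ H : Matrix (Fin p) (Fin p) ℝ, H.transpose = H ∧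
      (A * A.transpose) * H * (A * A.transpose) = A * A.transpose ∧
      H * (A * A.transpose) * H = H ∧
      (A * A.transpose) * H = H * (A * A.transpose) := by
    have hG : (A * A.transpose).IsHermitian := by
      simpa using Matrix.isHermitian_mul_conjTranspose_self A
    obtain ⟨U, lam, hUU, hs⟩ : ∃ (U : Matrix (Fin p) (Fin p) ℝ) (lam : Fin p → ℝ),
        star U * U = 1 ∧ A * A.transpose = U * Matrix.diagonal lam * star U := by
      refine ⟨(hG.eigenvectorUnitary).1, hG.eigenvalues,
        Unitary.coe_star_mul_self hG.eigenvectorUnitary, ?_⟩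
      conv_lhs => rw [hG.spectral_theorem]
      rfl
    have key : ∀ d e : Fin p → ℝ, (U * Matrix.diagonal d * star U) *
        (U * Matrix.diagonal e * star U) = U * Matrix.diagonal (fun i => d i * e i) * star U := by
      intro d e
      calc _ = U * Matrix.diagonal d * (star U * U) * Matrix.diagonal e * star U := by
            simp only [Matrix.mul_assoc]
        _ = _ := by rw [hUU, Matrix.mul_one, Matrix.mul_assoc U, Matrix.diagonal_mul_diagonal]
    refine ⟨U * Matrix.diagonal (fun i => (lam i)⁻¹) * star U, ?_, ?_, ?_, ?_⟩
    · simp [Matrix.transpose_mul, Matrix.star_eq_conjTranspose, Matrix.mul_assoc]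
    · rw [hs, key, key]
      simp only [mul_inv_mul_cancel]
    · rw [hs, key, key]
      have : ∀ x : ℝ, x⁻¹ * x * x⁻¹ = x⁻¹ := fun x => by simpa using mul_inv_mul_cancel x⁻¹
      simp only [this]
    · rw [hs, key, key]
      simp only [mul_comm]
  refine ⟨A.transpose * H, ?_, ?_, ?_, ?_⟩
  · set B := A * (A.transpose * H) * A - A with hB
    have hBB : B * B.transpose = 0 := by
      have e1 : B = (A * A.transpose) * H * A - A := by simp only [hB, Matrix.mul_assoc]
      have e2 : B * A.transpose = 0 := by
        rw [e1, Matrix.sub_mul, Matrix.mul_assoc _ A, h1, sub_self]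
      have e3 : B.transpose = A.transpose * (H * (A * A.transpose)) - A.transpose := by
        rw [e1]
        simp [Matrix.transpose_mul, hH, Matrix.mul_assoc]
      rw [e3, Matrix.mul_sub, ← Matrix.mul_assoc, e2, Matrix.zero_mul, sub_zero]
    have : B = 0 := by
      apply Matrix.self_mul_conjTranspose_eq_zero.mp
      simpa using hBB
    exact sub_eq_zero.mp this
  · calc _ = A.transpose * (H * (A * A.transpose) * H) := by simp only [Matrix.mul_assoc]
      _ = _ := by rw [h2]
  · rw [← Matrix.mul_assoc, Matrix.transpose_mul, hH, Matrix.transpose_mul,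
      Matrix.transpose_transpose, h3]
  · simp [Matrix.transpose_mul, hH, Matrix.mul_assoc]

/-- The Moore–Penrose pseudo-inverse `A⁺`. -/
def pinv {p q : ℕ} (A : Matrix (Fin p) (Fin q) ℝ) : Matrix (Fin q) (Fin p) ℝ :=
  Classical.choose (exists_isMoorePenrose A)

theorem pinv_spec {p q : ℕ} (A : Matrix (Fin p) (Fin q) ℝ) : IsMoorePenrose A (pinv A) :=
  Classical.choose_spec (exists_isMoorePenrose A)

theorem IsMoorePenrose.unique {p q : ℕ} {A : Matrix (Fin p) (Fin q) ℝ}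
    {X Y : Matrix (Fin q) (Fin p) ℝ} (hX : IsMoorePenrose A X) (hY : IsMoorePenrose A Y) :
    X = Y := by
  have hA : A * X = A * Y := by
    calc A * X = (A * X).transpose := hX.symm.symm
      _ = ((A * Y) * (A * X)).transpose := by rw [← Matrix.mul_assoc, hY.mul_mul]
      _ = (A * X) * (A * Y) := by rw [Matrix.transpose_mul, hX.symm, hY.symm]
      _ = A * Y := by rw [← Matrix.mul_assoc, hX.mul_mul]
  have hB : X * A = Y * A := by
    calc X * A = (X * A).transpose := hX.symm'.symm
      _ = ((X * A) * (Y * A)).transpose := by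
          rw [Matrix.mul_assoc, ← Matrix.mul_assoc A, hY.mul_mul]
      _ = (Y * A) * (X * A) := by rw [Matrix.transpose_mul, hX.symm', hY.symm']
      _ = Y * A := by rw [Matrix.mul_assoc, ← Matrix.mul_assoc A, hX.mul_mul]
  calc X = X * A * X := hX.mul_mul'.symm
    _ = Y * A * Y := by rw [Matrix.mul_assoc, hA, ← Matrix.mul_assoc, hB]
    _ = Y := hY.mul_mul'

/-! ## The `ℓ²`-optimal dictionary problem -/

/-- The mean `μ = E[V]` of the distribution `P`. -/
def mean {n : ℕ} (P : Measure (EuclideanSpace ℝ (Fin n))) : EuclideanSpace ℝ (Fin n) :=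
  ∫ v, v ∂P

/-- The variance (covariance matrix) `Σ* = var(V) = E[(V - μ)(V - μ)ᵀ]` of `P`. -/
def varMatrix {n : ℕ} (P : Measure (EuclideanSpace ℝ (Fin n))) : Matrix (Fin n) (Fin n) ℝ :=
  Matrix.of fun i j => ProbabilityTheory.covariance (fun v => v i) (fun v => v j) P

/-- `R_V(c)`: the support of `P` translated by `-c`. -/
def shiftedSupport {n : ℕ} (P : Measure (EuclideanSpace ℝ (Fin n)))
    (c : EuclideanSpace ℝ (Fin n)) : Set (EuclideanSpace ℝ (Fin n)) :=
  {v | v + c ∈ P.support}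

/-- The expected cost `E_P[‖f(V)‖²]` of a scheme of representation `f`. -/
def cost {n K : ℕ} (P : Measure (EuclideanSpace ℝ (Fin n)))
    (f : EuclideanSpace ℝ (Fin n) → EuclideanSpace ℝ (Fin K)) : ENNReal :=
  ∫⁻ v, ‖f v‖ₑ ^ 2 ∂P

/-- Feasible triples: constant `c`, dictionary `d` with `⟨dᵢ, dᵢ⟩ = ℓᵢ` whose span contains
`R_V(c)`, and a scheme `f` with `V - c = ∑ᵢ fᵢ(V) dᵢ` almost surely. -/
structure IsFeasible {n K : ℕ} (P : Measure (EuclideanSpace ℝ (Fin n))) (ℓ : Fin K → ℝ)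
    (c : EuclideanSpace ℝ (Fin n)) (d : Fin K → EuclideanSpace ℝ (Fin n))
    (f : EuclideanSpace ℝ (Fin n) → EuclideanSpace ℝ (Fin K)) : Prop where
  lengths : ∀ i, inner ℝ (d i) (d i) = ℓ i
  span : shiftedSupport P c ⊆ Submodule.span ℝ (Set.range d)
  measurable : Measurable f
  represents : ∀ᵐ v ∂P, v - c = ∑ i, f v i • d i

/-- `(c, d, f)` solves the `ℓ²`-optimal dictionary problem. -/
def IsOptimal {n K : ℕ} (P : Measure (EuclideanSpace ℝ (Fin n))) (ℓ : Fin K → ℝ)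
    (c : EuclideanSpace ℝ (Fin n)) (d : Fin K → EuclideanSpace ℝ (Fin n))
    (f : EuclideanSpace ℝ (Fin n) → EuclideanSpace ℝ (Fin K)) : Prop :=
  IsFeasible P ℓ c d f ∧ ∀ c' d' f', IsFeasible P ℓ c' d' f' → cost P f ≤ cost P f'

/-- The matrix `(d₁ d₂ ⋯ d_K)` with the dictionary vectors as columns. -/
def dictMatrix {n K : ℕ} (d : Fin K → EuclideanSpace ℝ (Fin n)) : Matrix (Fin n) (Fin K) ℝ :=
  Matrix.of fun a i => d i a

/-- The scheme `v ↦ (d₁ ⋯ d_K)⁺ (v - c)` for the dictionary `d` and the constant `c`. -/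
def scheme {n K : ℕ} (c : EuclideanSpace ℝ (Fin n)) (d : Fin K → EuclideanSpace ℝ (Fin n)) :
    EuclideanSpace ℝ (Fin n) → EuclideanSpace ℝ (Fin K) :=
  fun v => Matrix.toEuclideanLin (pinv (dictMatrix d)) (v - c)

/-! ## The algorithm

Each procedure leaves some choices open (eigenvectors, order of ties), so it is a relation between
inputs and possible outputs. -/

/-- `σ`, `u` list the nonzero eigenvalues of the positive semidefinite matrix `S` of rank `m`, in
non-increasing order and with multiplicity, and corresponding orthonormal eigenvectors. -/
structure IsEigenDecomp {n m : ℕ} (S : Matrix (Fin n) (Fin n) ℝ) (σ : Fin m → ℝ)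
    (u : Fin m → EuclideanSpace ℝ (Fin n)) : Prop where
  rank_eq : S.rank = m
  pos : ∀ i, 0 < σ i
  antitone : Antitone σ
  orthonormal : Orthonormal ℝ u
  eigen : ∀ i, Matrix.toEuclideanLin S (u i) = σ i • u i

/-- `⟨x, A x⟩`. -/
def quad {K : ℕ} (A : Matrix (Fin K) (Fin K) ℝ) (x : EuclideanSpace ℝ (Fin K)) : ℝ :=
  inner ℝ x (Matrix.toEuclideanLin A x)

/-- `vs` is an `A`-sort of `us`: a permutation of `us` along which `⟨v, A v⟩` is non-increasing. -/
def IsSort {K : ℕ} (A : Matrix (Fin K) (Fin K) ℝ) (us vs : List (EuclideanSpace ℝ (Fin K))) :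
    Prop :=
  vs.Perm us ∧ vs.Pairwise fun x y => quad A y ≤ quad A x

/-- `Θ = √(a - b') / (√(a - b') + √(b - a))`, where `b = ⟨u₁, A u₁⟩` and `b' = ⟨uᵢ, A uᵢ⟩`. -/
def theta (a b b' : ℝ) : ℝ := √(a - b') / (√(a - b') + √(b - a))

/-- The loop of the orthonormal basis procedure: from the current vectors and the
remaining prescribed values it produces the vectors `x_t, x_{t+1}, …`. -/
inductive OrthoLoop {K : ℕ} (A : Matrix (Fin K) (Fin K) ℝ) :
    List (EuclideanSpace ℝ (Fin K)) → List ℝ → List (EuclideanSpace ℝ (Fin K)) → Prop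
  | done : OrthoLoop A [] [] []
  | case1 {u₁ us a as us' xs} (h : quad A u₁ = a) (hs : IsSort A us us')
      (hl : OrthoLoop A us' as xs) : OrthoLoop A (u₁ :: us) (a :: as) (u₁ :: xs)
  /-- `w` is the vector `uᵢ`; `pre` are the vectors strictly between `u₁` and `uᵢ`, so that
  `u_{i-1}` is the last element of `u₁ :: pre`. -/
  | case2 {u₁ pre w post a as us' xs} (h : a < quad A u₁) (hw : quad A w ≤ a)
      (hp : a < quad A ((u₁ :: pre).getLast (List.cons_ne_nil _ _))) (Θ r : ℝ)
      (hΘ : Θ = theta a (quad A u₁) (quad A w)) (hr : r = √(Θ ^ 2 + (1 - Θ) ^ 2))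
      (hs : IsSort A (r⁻¹ • ((1 - Θ) • u₁ - Θ • w) :: (pre ++ post)) us')
      (hl : OrthoLoop A us' as xs) :
      OrthoLoop A (u₁ :: (pre ++ w :: post)) (a :: as)
        (r⁻¹ • (Θ • u₁ + (1 - Θ) • w) :: xs)

/-- Output `x` of the orthonormal basis procedure on input `A`, `ℓ`: start from an `A`-sorted
orthonormal basis of eigenvectors of `(A + Aᵀ) / 2` and run the loop. -/
def IsOrthoBasisOutput {K : ℕ} (A : Matrix (Fin K) (Fin K) ℝ) (ℓ : Fin K → ℝ)
    (x : Fin K → EuclideanSpace ℝ (Fin K)) : Prop :=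
  ∃ (e : Fin K → EuclideanSpace ℝ (Fin K)) (us : List (EuclideanSpace ℝ (Fin K))),
    Orthonormal ℝ e ∧
    (∀ i, ∃ κ : ℝ,
      Matrix.toEuclideanLin ((1 / 2 : ℝ) • (A + A.transpose)) (e i) = κ • e i) ∧
    IsSort A (List.ofFn e) us ∧ OrthoLoop A us (List.ofFn ℓ) (List.ofFn x)

/-- Output `y` of the rank-1 decomposition procedure on input `M`, `ℓ`: with
`C = (√κ₁ w₁ ⋯ √κᵣ wᵣ 0 ⋯ 0)` and `Λ = diag(κ₁, …, κᵣ, 0, …, 0)`, put `yᵢ = C xᵢ` where `x` is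
the output of the orthonormal basis procedure on `Λ`, `ℓ`. -/
def IsRankOneOutput {n K : ℕ} (M : Matrix (Fin n) (Fin n) ℝ) (ℓ : Fin K → ℝ)
    (y : Fin K → EuclideanSpace ℝ (Fin n)) : Prop :=
  ∃ (r : ℕ) (_ : r ≤ K) (κ : Fin r → ℝ) (w : Fin r → EuclideanSpace ℝ (Fin n))
    (x : Fin K → EuclideanSpace ℝ (Fin K)),
    IsEigenDecomp M κ w ∧
    IsOrthoBasisOutput
      (Matrix.diagonal fun k : Fin K => if h : (k : ℕ) < r then κ ⟨k, h⟩ else 0) ℓ x ∧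
    ∀ i, y i = Matrix.toEuclideanLin
      (Matrix.of fun (a : Fin n) (k : Fin K) =>
        if h : (k : ℕ) < r then √(κ ⟨k, h⟩) * w ⟨k, h⟩ a else 0) (x i)

/-- `ℓ'ᵢ = ℓᵢ` for `i < m` and `ℓ'_m = ∑_{j = m}^{K} ℓⱼ` (indices from `1`). -/
def lumped {K m : ℕ} (hm : m ≤ K) (ℓ : Fin K → ℝ) : Fin m → ℝ := fun i =>
  if (i : ℕ) + 1 < m then ℓ (Fin.castLE hm i) else ∑ j ∈ Finset.univ.filter (fun j : Fin K => (i : ℕ) ≤ j), ℓ j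

/-- `φ` is an optimal solution of the quadratic program: minimize `∑ₜ aₜ φₜ² - 2 √σₜ φₜ` subject
to `0 ≤ φ₁ ≤ ⋯ ≤ φ_m`. -/
def IsQPSolution {m : ℕ} (a σ φ : Fin m → ℝ) : Prop :=
  (Monotone φ ∧ ∀ t, 0 ≤ φ t) ∧
    ∀ ψ : Fin m → ℝ, Monotone ψ → (∀ t, 0 ≤ ψ t) →
      ∑ t, (a t * φ t ^ 2 - 2 * √(σ t) * φ t) ≤ ∑ t, (a t * ψ t ^ 2 - 2 * √(σ t) * ψ t)

/-- The set `{n₁, …, n_L}`: the first index, and all `t` with `φ_{t-1} < φ_t`. -/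
def breakpoints {m : ℕ} (φ : Fin m → ℝ) : Set (Fin m) :=
  {t | ∀ s : Fin m, (s : ℕ) + 1 = t → φ s < φ t}

open Classical in
/-- The block `{n_l, …, n_{l+1} - 1}` that contains `i`, for the set `N` of breakpoints. -/
def block {m : ℕ} (N : Set (Fin m)) (i : Fin m) : Finset (Fin m) :=
  Finset.univ.filter fun j => ∀ t ∈ N, t ≤ i ↔ t ≤ j

/-- The map `λ(c, a, N)`: `λᵢ = cᵢ (∑_{block of i} aⱼ) / (∑_{block of i} cⱼ)`. -/
def eigvalMap {m : ℕ} (c a : Fin m → ℝ) (N : Set (Fin m)) : Fin m → ℝ := fun i =>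
  c i * ((∑ j ∈ block N i, a j) / ∑ j ∈ block N i, c j)

/-- `d` is a dictionary that the algorithm can output on input `S` (variance) and `ℓ`. -/
def IsAlgorithmOutput {n K : ℕ} (ℓ : Fin K → ℝ) (S : Matrix (Fin n) (Fin n) ℝ)
    (d : Fin K → EuclideanSpace ℝ (Fin n)) : Prop :=
  ∃ (m : ℕ) (hm : m ≤ K) (σ : Fin m → ℝ) (u : Fin m → EuclideanSpace ℝ (Fin n))
    (φ : Fin m → ℝ),
    IsEigenDecomp S σ u ∧ IsQPSolution (lumped hm ℓ) σ φ ∧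
    IsRankOneOutput
      (∑ i, eigvalMap (fun t => √(σ t)) (lumped hm ℓ) (breakpoints φ) i •
        Matrix.vecMulVec (u i).ofLp (u i).ofLp) ℓ d

end

end L2Dict

/-! Write `D` for the output matrix on input `S`, with eigendata `σ`, `u` and quadratic-program
solution `φ`. The choices left open matter little, because `D Dᵀ = ∑ λᵢ uᵢ uᵢᵀ` with `λᵢ = √σᵢ / φᵢ`
(`IsAlgorithmOutput.spec`), and the cost of the scheme depends on `D` only through `D Dᵀ`: with
constant `x` it is `∑ λᵢ⁻¹ (⟨uᵢ, Σ* uᵢ⟩ + ⟨uᵢ, μ - x⟩²)` (`cost_scheme`). At the true mean and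
variance this is `∑ √σᵢ φᵢ`.

The vector `φ` acts as a family of multipliers. Its first-order conditions, tested on functions that
are constant on the level sets of `φ`, identify the block formula with `√σ / φ` and give `∑ ℓ'ₜ φₜ²
= ∑ √σₜ φₜ`; tested on a truncation of `-1/φ` they show that `λ`, padded by zeros, majorizes `ℓ`.
Majorization is the Schur–Horn condition, and it is the invariant that keeps the rotation loop from
getting stuck (`exists_orthoLoop`), so an output exists.

Optimality is weak duality (`sum_mul_sqrt_le_sum_quad_div`, `le_cost_of_isFeasible`). For a feasible
dictionary whose Gram-type matrix `D Dᵀ` has nonzero eigenvalues `cⱼ` and eigenvectors `vⱼ`, the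
cost is at least `∑ τⱼ² / cⱼ` with `τⱼ² = ⟨vⱼ, Σ* vⱼ⟩`. Each term is at least `2 gⱼ τⱼ - cⱼ gⱼ²`,
where `g` is `φ` extended constantly. Two rearrangement inequalities bound `∑ gⱼ τⱼ` below and `∑ cⱼ
gⱼ²` above by `∑ √σᵢ φᵢ`.

For the limit, neither eigenvectors nor dictionaries need converge. Along an ultrafilter the data
`(σ, u, φ)` do converge by compactness, and constant rank makes the limit an eigendecomposition of
`Σ*` with a solution of its quadratic program. The costs then tend to `∑ √σ₀ φ₀`, which is the
optimal cost whatever the limit point (`sum_sqrt_mul_eq`). -/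

namespace L2Dict

/-! ### Spectral sums `∑ cᵢ uᵢ uᵢᵀ` and eigendecompositions of a given rank. -/

section LinearAlgebra

theorem toEuclideanLin_mul_apply {p q r : ℕ} (A : Matrix (Fin p) (Fin q) ℝ)
    (B : Matrix (Fin q) (Fin r) ℝ) (x : EuclideanSpace ℝ (Fin r)) :
    Matrix.toEuclideanLin (A * B) x = Matrix.toEuclideanLin A (Matrix.toEuclideanLin B x) := by
  simp [Matrix.toLpLin_apply, Matrix.mulVec_mulVec]

theorem inner_toEuclideanLin_right {p q : ℕ} (A : Matrix (Fin p) (Fin q) ℝ)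
    (x : EuclideanSpace ℝ (Fin p)) (y : EuclideanSpace ℝ (Fin q)) :
    inner ℝ x (Matrix.toEuclideanLin A y) = inner ℝ (Matrix.toEuclideanLin A.transpose x) y := by
  simp only [Matrix.toLpLin_apply, EuclideanSpace.inner_eq_star_dotProduct, star_trivial]
  rw [Matrix.mulVec_transpose, dotProduct_comm, dotProduct_comm y.ofLp, Matrix.dotProduct_mulVec]

/-- The matrix `∑ᵢ cᵢ uᵢ uᵢᵀ`. -/
noncomputable def specMat {n m : ℕ} (c : Fin m → ℝ) (u : Fin m → EuclideanSpace ℝ (Fin n)) :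
    Matrix (Fin n) (Fin n) ℝ :=
  ∑ i, c i • Matrix.vecMulVec (u i).ofLp (u i).ofLp

theorem specMat_apply {n m : ℕ} (c : Fin m → ℝ) (u : Fin m → EuclideanSpace ℝ (Fin n))
    (a b : Fin n) : specMat c u a b = ∑ i, c i * (u i a * u i b) := by
  simp [specMat, Matrix.sum_apply, Matrix.vecMulVec_apply]

theorem specMat_transpose {n m : ℕ} (c : Fin m → ℝ) (u : Fin m → EuclideanSpace ℝ (Fin n)) :
    (specMat c u).transpose = specMat c u := by
  ext a b
  simp only [Matrix.transpose_apply, specMat_apply, mul_comm]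

theorem toEuclideanLin_specMat {n m : ℕ} (c : Fin m → ℝ) (u : Fin m → EuclideanSpace ℝ (Fin n))
    (x : EuclideanSpace ℝ (Fin n)) :
    Matrix.toEuclideanLin (specMat c u) x = ∑ i, (c i * inner ℝ (u i) x) • u i := by
  ext a
  simp only [Matrix.toLpLin_apply, Matrix.mulVec, dotProduct, specMat_apply, PiLp.inner_apply,
    WithLp.ofLp_sum, WithLp.ofLp_smul, Finset.sum_apply, Pi.smul_apply, smul_eq_mul,
    Finset.sum_mul, Finset.mul_sum]
  rw [Finset.sum_comm]
  refine Finset.sum_congr rfl fun i _ => Finset.sum_congr rfl fun b _ => ?_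
  simp only [RCLike.inner_apply, conj_trivial]
  ring

theorem matrix_ext_toEuclideanLin {p q : ℕ} {A B : Matrix (Fin p) (Fin q) ℝ}
    (h : ∀ x, Matrix.toEuclideanLin A x = Matrix.toEuclideanLin B x) : A = B :=
  Matrix.toEuclideanLin.injective (LinearMap.ext h)

theorem specMat_mul {n m : ℕ} (c c' : Fin m → ℝ) {u : Fin m → EuclideanSpace ℝ (Fin n)}
    (hu : Orthonormal ℝ u) : specMat c u * specMat c' u = specMat (fun i => c i * c' i) u := by
  refine matrix_ext_toEuclideanLin fun x => ?_
  rw [toEuclideanLin_mul_apply, toEuclideanLin_specMat, toEuclideanLin_specMat,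
    toEuclideanLin_specMat]
  refine Finset.sum_congr rfl fun i _ => ?_
  rw [hu.inner_right_fintype]
  ring_nf

theorem quad_specMat {n m : ℕ} (c : Fin m → ℝ) (u : Fin m → EuclideanSpace ℝ (Fin n))
    (x : EuclideanSpace ℝ (Fin n)) : quad (specMat c u) x = ∑ i, c i * inner ℝ (u i) x ^ 2 := by
  rw [quad, toEuclideanLin_specMat, inner_sum]
  refine Finset.sum_congr rfl fun i _ => ?_
  rw [inner_smul_right, real_inner_comm]
  ring

theorem toEuclideanLin_specMat_self {n m : ℕ} (c : Fin m → ℝ)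
    {u : Fin m → EuclideanSpace ℝ (Fin n)} (hu : Orthonormal ℝ u) (i : Fin m) :
    Matrix.toEuclideanLin (specMat c u) (u i) = c i • u i := by
  rw [toEuclideanLin_specMat, Finset.sum_eq_single i]
  · simp [hu.1 i]
  · intro j _ hj
    rw [hu.2 hj]
    simp
  · simp

theorem rank_eq_finrank_range {p q : ℕ} (A : Matrix (Fin p) (Fin q) ℝ) :
    A.rank = Module.finrank ℝ (LinearMap.range (Matrix.toEuclideanLin A)) :=
  Matrix.rank_eq_finrank_range_toLin A (PiLp.basisFun 2 ℝ (Fin p)) (PiLp.basisFun 2 ℝ (Fin q))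

theorem finrank_span_orthonormal {n m : ℕ} {u : Fin m → EuclideanSpace ℝ (Fin n)}
    (hu : Orthonormal ℝ u) : Module.finrank ℝ (Submodule.span ℝ (Set.range u)) = m := by
  rw [finrank_span_eq_card hu.linearIndependent, Fintype.card_fin]

theorem span_le_range_of_eigen {n m : ℕ} {S : Matrix (Fin n) (Fin n) ℝ} {σ : Fin m → ℝ}
    {u : Fin m → EuclideanSpace ℝ (Fin n)} (hσ : ∀ i, σ i ≠ 0)
    (h : ∀ i, Matrix.toEuclideanLin S (u i) = σ i • u i) :
    Submodule.span ℝ (Set.range u) ≤ LinearMap.range (Matrix.toEuclideanLin S) := by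
  rw [Submodule.span_le]
  rintro _ ⟨i, rfl⟩
  exact ⟨(σ i)⁻¹ • u i, by rw [map_smul, h, smul_smul, inv_mul_cancel₀ (hσ i), one_smul]⟩

theorem range_specMat_le {n m : ℕ} (c : Fin m → ℝ) (u : Fin m → EuclideanSpace ℝ (Fin n)) :
    LinearMap.range (Matrix.toEuclideanLin (specMat c u)) ≤
      Submodule.span ℝ (Set.range u) := by
  rintro _ ⟨x, rfl⟩
  rw [toEuclideanLin_specMat]
  exact Submodule.sum_mem _ fun i _ => Submodule.smul_mem _ _ (Submodule.subset_span ⟨i, rfl⟩)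

theorem isEigenDecomp_specMat {n m : ℕ} {c : Fin m → ℝ} {u : Fin m → EuclideanSpace ℝ (Fin n)}
    (hu : Orthonormal ℝ u) (hc : ∀ i, 0 < c i) (hanti : Antitone c) :
    IsEigenDecomp (specMat c u) c u where
  rank_eq := by
    rw [rank_eq_finrank_range, le_antisymm (range_specMat_le c u)
      (span_le_range_of_eigen (fun i => (hc i).ne') (toEuclideanLin_specMat_self c hu)),
      finrank_span_orthonormal hu]
  pos := hc
  antitone := hanti
  orthonormal := hu
  eigen := toEuclideanLin_specMat_self c hu

/-- Subtracting the projection to the span of an orthonormal family leaves a vector orthogonal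
to the family. -/
theorem inner_sub_proj {n m : ℕ} {u : Fin m → EuclideanSpace ℝ (Fin n)} (hu : Orthonormal ℝ u)
    (x : EuclideanSpace ℝ (Fin n)) (i : Fin m) :
    inner ℝ (u i) (x - ∑ j, (inner ℝ (u j) x) • u j) = 0 := by
  rw [inner_sub_right, hu.inner_right_fintype, sub_self]

/-- By the rank count the eigenvectors span the range of `S`, and a symmetric matrix kills the
orthogonal complement of its range. -/
theorem IsEigenDecomp.eq_specMat {n m : ℕ} {S : Matrix (Fin n) (Fin n) ℝ} {σ : Fin m → ℝ}
    {u : Fin m → EuclideanSpace ℝ (Fin n)} (h : IsEigenDecomp S σ u) (hS : S.transpose = S) :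
    S = specMat σ u := by
  have hr : Submodule.span ℝ (Set.range u) = LinearMap.range (Matrix.toEuclideanLin S) := by
    refine Submodule.eq_of_le_of_finrank_eq
      (span_le_range_of_eigen (fun i => (h.pos i).ne') h.eigen) ?_
    rw [finrank_span_orthonormal h.orthonormal, ← rank_eq_finrank_range, h.rank_eq]
  have hker : ∀ y, (∀ i, inner ℝ (u i) y = 0) → Matrix.toEuclideanLin S y = 0 := by
    intro y hy
    have h1 : Matrix.toEuclideanLin S y ∈ Submodule.span ℝ (Set.range u) := by
      rw [hr]; exact ⟨y, rfl⟩
    have h2 : ∀ z ∈ Submodule.span ℝ (Set.range u), inner ℝ z (Matrix.toEuclideanLin S y) = 0 := by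
      intro z hz
      induction hz using Submodule.span_induction with
      | mem z hz =>
        obtain ⟨i, rfl⟩ := hz
        rw [inner_toEuclideanLin_right, hS, h.eigen, inner_smul_left, hy, mul_zero]
      | zero => simp
      | add a b _ _ ha hb => rw [inner_add_left, ha, hb, add_zero]
      | smul c a _ ha => rw [inner_smul_left, ha, mul_zero]
    exact inner_self_eq_zero.mp (h2 _ h1)
  refine matrix_ext_toEuclideanLin fun x => ?_
  have h3 := hker _ (inner_sub_proj h.orthonormal x)
  rw [map_sub, sub_eq_zero] at h3
  rw [h3, toEuclideanLin_specMat, map_sum]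
  refine Finset.sum_congr rfl fun i _ => ?_
  rw [map_smul, h.eigen, smul_smul, mul_comm]

theorem exists_isEigenDecomp {n : ℕ} {S : Matrix (Fin n) (Fin n) ℝ} (hS : S.PosSemidef) :
    ∃ (σ : Fin S.rank → ℝ) (u : Fin S.rank → EuclideanSpace ℝ (Fin n)), IsEigenDecomp S σ u := by
  have hc : Fintype.card (Fin n) = n := Fintype.card_fin n
  have hH := hS.isHermitian
  let e : Fin (Fintype.card (Fin n)) ≃ Fin n := Fintype.equivOfCardEq (Fintype.card_fin _)
  have he : ∀ k, hH.eigenvalues (e k) = hH.eigenvalues₀ k := by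
    intro k
    simp [Matrix.IsHermitian.eigenvalues, e]
  have hnn : ∀ k, 0 ≤ hH.eigenvalues₀ k := fun k => he k ▸ hS.eigenvalues_nonneg _
  have hrank : S.rank = (Finset.univ.filter fun k => hH.eigenvalues₀ k ≠ 0).card := by
    rw [hH.rank_eq_card_non_zero_eigs, ← Fintype.card_subtype]
    exact (Fintype.card_congr (e.subtypeEquiv fun k => by rw [he])).symm
  have hle : S.rank ≤ Fintype.card (Fin n) := by
    rw [hrank]; exact (Finset.card_filter_le _ _).trans (by simp)
  -- The sorted eigenvalues are nonnegative, so a zero at position `k` forces zeros from there on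
  -- and at most `k` nonzero values.
  have hpos : ∀ k : Fin (Fintype.card (Fin n)), (k : ℕ) < S.rank → 0 < hH.eigenvalues₀ k := by
    intro k hk
    by_contra hneg
    have hz : hH.eigenvalues₀ k = 0 := le_antisymm (not_lt.mp hneg) (hnn k)
    have : (Finset.univ.filter fun k => hH.eigenvalues₀ k ≠ 0) ⊆ Finset.Iio k := by
      intro j hj
      rw [Finset.mem_filter] at hj
      rw [Finset.mem_Iio]
      by_contra hjk
      exact hj.2 (le_antisymm (hz ▸ hH.eigenvalues₀_antitone (not_lt.mp hjk)) (hnn j))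
    have := Finset.card_le_card this
    rw [← hrank, Fin.card_Iio] at this
    omega
  refine ⟨fun i => hH.eigenvalues₀ (Fin.castLE hle i),
    fun i => hH.eigenvectorBasis (e (Fin.castLE hle i)), rfl, fun i => hpos _ i.2,
    fun i j hij => hH.eigenvalues₀_antitone hij, ?_, ?_⟩
  · exact hH.eigenvectorBasis.orthonormal.comp _
      (e.injective.comp (Fin.castLE_injective hle))
  · intro i
    rw [← he, Matrix.toLpLin_apply, hH.mulVec_eigenvectorBasis]
    rfl

theorem quad_smul_add {K : ℕ} (A : Matrix (Fin K) (Fin K) ℝ) (x y : EuclideanSpace ℝ (Fin K))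
    (r α β : ℝ) (h1 : inner ℝ x (Matrix.toEuclideanLin A y) = 0)
    (h2 : inner ℝ y (Matrix.toEuclideanLin A x) = 0) :
    quad A (r • (α • x + β • y)) = r ^ 2 * (α ^ 2 * quad A x + β ^ 2 * quad A y) := by
  simp only [quad, map_smul, map_add, inner_smul_left, inner_smul_right, inner_add_left,
    inner_add_right, h1, h2, conj_trivial]
  ring

end LinearAlgebra

/-! ### First-order conditions, block formula and existence for the quadratic program. -/

section QuadraticProgram

variable {m : ℕ} {a σ φ : Fin m → ℝ}

/-- Variational inequality: only constraints active at `φ` restrict a direction `g`, since the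
strict ones survive a small step `ε`. The sum is half the directional derivative of the objective.
-/
theorem IsQPSolution.nonneg_of_feasible_direction (h : IsQPSolution a σ φ) (g : Fin m → ℝ)
    (hmono : ∀ t t', t ≤ t' → φ t = φ t' → g t ≤ g t') (hz : ∀ t, φ t = 0 → 0 ≤ g t) :
    0 ≤ ∑ t, (a t * φ t - √(σ t)) * g t := by
  have hlt : ∀ x y p q : ℝ, x < y → ∀ᶠ ε in 𝓝[>] (0 : ℝ), x + ε * p ≤ y + ε * q := by
    intro x y p q hxy
    have hx : Tendsto (fun ε : ℝ => x + ε * p) (𝓝[>] 0) (𝓝 (x + 0 * p)) :=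
      (Continuous.tendsto (by fun_prop) 0).mono_left nhdsWithin_le_nhds
    have hy : Tendsto (fun ε : ℝ => y + ε * q) (𝓝[>] 0) (𝓝 (y + 0 * q)) :=
      (Continuous.tendsto (by fun_prop) 0).mono_left nhdsWithin_le_nhds
    exact (hx.eventually_lt hy (by simpa using hxy)).mono fun _ h => h.le
  have h1 : ∀ᶠ ε in 𝓝[>] (0 : ℝ), ∀ t t', t ≤ t' → φ t + ε * g t ≤ φ t' + ε * g t' := by
    refine eventually_all.2 fun t => eventually_all.2 fun t' => ?_
    by_cases htt : t ≤ t'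
    · rcases (h.1.1 htt).lt_or_eq with hlt' | heq
      · exact (hlt _ _ _ _ hlt').mono fun _ h _ => h
      · filter_upwards [self_mem_nhdsWithin] with ε hε _
        rw [heq]
        gcongr
        · exact (Set.mem_Ioi.1 hε).le
        · exact hmono t t' htt heq
    · exact Eventually.of_forall fun _ h => absurd h htt
  have h2 : ∀ᶠ ε in 𝓝[>] (0 : ℝ), ∀ t, 0 ≤ φ t + ε * g t := by
    refine eventually_all.2 fun t => ?_
    rcases (h.1.2 t).lt_or_eq with hlt' | heq
    · simpa using hlt 0 (φ t) 0 (g t) hlt'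
    · filter_upwards [self_mem_nhdsWithin] with ε hε
      rw [← heq, zero_add]
      exact mul_nonneg (Set.mem_Ioi.1 hε).le (hz t heq.symm)
  have h3 : ∀ᶠ ε in 𝓝[>] (0 : ℝ),
      0 ≤ 2 * ∑ t, (a t * φ t - √(σ t)) * g t + ε * ∑ t, a t * g t ^ 2 := by
    filter_upwards [h1, h2, self_mem_nhdsWithin] with ε h1 h2 hε
    have hε' : 0 < ε := hε
    have key := h.2 (fun t => φ t + ε * g t) (fun t t' => h1 t t') h2
    have : ∑ t, (a t * (φ t + ε * g t) ^ 2 - 2 * √(σ t) * (φ t + ε * g t)) =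
        ∑ t, (a t * φ t ^ 2 - 2 * √(σ t) * φ t) +
          ε * (2 * ∑ t, (a t * φ t - √(σ t)) * g t + ε * ∑ t, a t * g t ^ 2) := by
      simp only [Finset.mul_sum, ← Finset.sum_add_distrib]
      exact Finset.sum_congr rfl fun t _ => by ring
    rw [this] at key
    exact nonneg_of_mul_nonneg_right (by linarith) hε'
  have h4 : Tendsto (fun ε : ℝ => 2 * ∑ t, (a t * φ t - √(σ t)) * g t + ε * ∑ t, a t * g t ^ 2)
      (𝓝[>] 0) (𝓝 (2 * ∑ t, (a t * φ t - √(σ t)) * g t + 0 * ∑ t, a t * g t ^ 2)) :=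
    (Continuous.tendsto (by fun_prop) 0).mono_left nhdsWithin_le_nhds
  have := ge_of_tendsto h4 h3
  linarith

/-- Raising all vanishing coordinates together is a feasible direction, with derivative proportional
to a negative sum of `-√σ`. -/
theorem IsQPSolution.pos (h : IsQPSolution a σ φ) (hσ : ∀ t, 0 < σ t) (t : Fin m) : 0 < φ t := by
  classical
  refine (h.1.2 t).lt_of_ne' fun h0 => ?_
  have key := h.nonneg_of_feasible_direction (fun t => if φ t = 0 then 1 else 0)
    (fun t t' _ e => by simp [e]) (fun t _ => by split_ifs; norm_num)
  have hneg : ∑ t, (a t * φ t - √(σ t)) * (if φ t = 0 then 1 else 0) < 0 := by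
    refine Finset.sum_neg' (fun i _ => ?_) ⟨t, Finset.mem_univ _, ?_⟩
    · split_ifs with hi
      · simp [hi, Real.sqrt_nonneg]
      · simp
    · simp [h0, hσ t]
  linarith

/-- A function of `φ` is constant on level sets and `φ > 0`, so both it and its negative are
feasible directions. The choices of `g` used are the identity, `-x⁻¹` and indicators of a value. -/
theorem IsQPSolution.sum_comp_eq_zero (h : IsQPSolution a σ φ) (hσ : ∀ t, 0 < σ t) (g : ℝ → ℝ) :
    ∑ t, (a t * φ t - √(σ t)) * g (φ t) = 0 := by
  have h1 := h.nonneg_of_feasible_direction (fun t => g (φ t)) (fun t t' _ e => by simp [e])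
    (fun t e => absurd e (h.pos hσ t).ne')
  have h2 := h.nonneg_of_feasible_direction (fun t => -g (φ t)) (fun t t' _ e => by simp [e])
    (fun t e => absurd e (h.pos hσ t).ne')
  simp only [mul_neg, Finset.sum_neg_distrib] at h2
  linarith

theorem IsQPSolution.sum_sq (h : IsQPSolution a σ φ) (hσ : ∀ t, 0 < σ t) :
    ∑ t, a t * φ t ^ 2 = ∑ t, √(σ t) * φ t := by
  have := h.sum_comp_eq_zero hσ id
  rw [← sub_eq_zero, ← Finset.sum_sub_distrib, ← this]
  exact Finset.sum_congr rfl fun t _ => by simp only [id]; ring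

theorem IsQPSolution.sum_div (h : IsQPSolution a σ φ) (hσ : ∀ t, 0 < σ t) :
    ∑ t, √(σ t) / φ t = ∑ t, a t := by
  have := h.sum_comp_eq_zero hσ fun x => -x⁻¹
  rw [← sub_eq_zero, ← Finset.sum_sub_distrib, ← this]
  refine Finset.sum_congr rfl fun t _ => ?_
  have := (h.pos hσ t).ne'
  field_simp
  ring

/-- The direction `-1/φ` cut off at `k` may split a level set, but there it only jumps up from a
negative value to `0`. Hence it is feasible, though its negative need not be, and an inequality
results. -/
theorem IsQPSolution.sum_le_sum_div (h : IsQPSolution a σ φ) (hσ : ∀ t, 0 < σ t) (k : ℕ) :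
    ∑ t with t.val < k, a t ≤ ∑ t with t.val < k, √(σ t) / φ t := by
  have := h.nonneg_of_feasible_direction (fun t => if t.val < k then -(φ t)⁻¹ else 0)
    (fun t t' htt e => by
      have := inv_pos.2 (h.pos hσ t')
      rw [e]
      split_ifs with h1 h2 h2
      · exact le_rfl
      · linarith
      · exact absurd (lt_of_le_of_lt (Fin.le_def.1 htt) h2) h1
      · exact le_rfl)
    (fun t e => absurd e (h.pos hσ t).ne')
  rw [Finset.sum_filter, Finset.sum_filter, ← sub_nonneg, ← Finset.sum_sub_distrib]
  refine this.trans_eq (Finset.sum_congr rfl fun t _ => ?_)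
  have := (h.pos hσ t).ne'
  split_ifs
  · field_simp
    ring
  · simp

theorem mem_block_breakpoints (hφ : Monotone φ) (i j : Fin m) :
    j ∈ block (breakpoints φ) i ↔ φ j = φ i := by
  classical
  -- The first index at which `φ` exceeds `φ i` is a breakpoint, and it separates `i` from `j`.
  have key : ∀ i j : Fin m, φ i < φ j → ∃ t ∈ breakpoints φ, t ≤ j ∧ ¬ t ≤ i := by
    intro i j hij
    have hne : (Finset.univ.filter fun t => φ i < φ t).Nonempty := ⟨j, by simpa using hij⟩
    have hmem := Finset.min'_mem _ hne
    have hle := Finset.min'_le (Finset.univ.filter fun t => φ i < φ t)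
    set t := Finset.min' _ hne
    simp only [Finset.mem_filter, Finset.mem_univ, true_and] at hmem hle
    refine ⟨t, fun s hs => ?_, hle j hij, fun hti => absurd (hφ hti) (not_le.2 hmem)⟩
    refine lt_of_le_of_lt (not_lt.1 fun hs' => ?_) hmem
    have : (t : ℕ) ≤ s := hle s hs'
    omega
  have key2 : ∀ i j t : Fin m, φ i = φ j → t ∈ breakpoints φ → t ≤ i → t ≤ j := by
    intro i j t hij ht hti
    by_contra htj
    have hjt : (j : ℕ) < t := not_le.1 htj
    have h1 := ht ⟨t - 1, by omega⟩ (by simp only; omega)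
    have h2 : φ j ≤ φ ⟨t - 1, by omega⟩ := hφ (by rw [Fin.le_def]; simp only; omega)
    have := hφ hti
    linarith
  simp only [block, Finset.mem_filter, Finset.mem_univ, true_and]
  constructor
  · intro h
    rcases lt_trichotomy (φ j) (φ i) with hlt | heq | hgt
    · obtain ⟨t, ht, h1, h2⟩ := key _ _ hlt
      exact absurd ((h t ht).1 h1) h2
    · exact heq
    · obtain ⟨t, ht, h1, h2⟩ := key _ _ hgt
      exact absurd ((h t ht).2 h1) h2
  · exact fun h t ht => ⟨key2 i j t h.symm ht, key2 j i t h ht⟩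

/-- Blocks are level sets of `φ`. Testing stationarity on the indicator of one gives `φᵢ ∑ aⱼ = ∑
√σⱼ` over that block. -/
theorem IsQPSolution.eigvalMap_eq (h : IsQPSolution a σ φ) (hσ : ∀ t, 0 < σ t) (i : Fin m) :
    eigvalMap (fun t => √(σ t)) a (breakpoints φ) i = √(σ i) / φ i := by
  classical
  have hb : block (breakpoints φ) i = Finset.univ.filter fun j => φ j = φ i := by
    ext j
    simp [mem_block_breakpoints h.1.1]
  have h1 := h.sum_comp_eq_zero hσ fun x => if x = φ i then 1 else 0
  simp only [mul_ite, mul_one, mul_zero, ← Finset.sum_filter] at h1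
  have h2 : φ i * ∑ j with φ j = φ i, a j = ∑ j with φ j = φ i, √(σ j) := by
    rw [← sub_eq_zero, Finset.mul_sum, ← Finset.sum_sub_distrib, ← h1]
    refine Finset.sum_congr rfl fun j hj => ?_
    rw [(Finset.mem_filter.1 hj).2]
    ring
  have hpos : 0 < ∑ j with φ j = φ i, √(σ j) :=
    Finset.sum_pos (fun j _ => Real.sqrt_pos.2 (hσ j)) ⟨i, by simp⟩
  have := (h.pos hσ i).ne'
  rw [eigvalMap, hb, mul_div_assoc', div_eq_div_iff hpos.ne' this, ← h2]
  ring

theorem antitone_sqrt_div (h : IsQPSolution a σ φ) (hσ : ∀ t, 0 < σ t) (hanti : Antitone σ) :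
    Antitone fun t => √(σ t) / φ t := fun _ _ htt =>
  div_le_div₀ (Real.sqrt_nonneg _) (Real.sqrt_le_sqrt (hanti htt)) (h.pos hσ _) (h.1.1 htt)

/-- Half of each quadratic term absorbs the linear term by completing the square. The bound supplies
compactness, both for existence of a minimizer and for limits of minimizers. -/
theorem mul_sq_le_of_qp_nonpos (ha : ∀ t, 0 < a t) (hσ : ∀ t, 0 ≤ σ t) {ψ : Fin m → ℝ}
    (h : ∑ t, (a t * ψ t ^ 2 - 2 * √(σ t) * ψ t) ≤ 0) (t : Fin m) :
    a t * ψ t ^ 2 ≤ 4 * ∑ i, σ i / a i := by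
  have h1 : ∀ i, a i / 2 * ψ i ^ 2 - 2 * (σ i / a i) ≤ a i * ψ i ^ 2 - 2 * √(σ i) * ψ i := by
    intro i
    have := ha i
    have hs := Real.sq_sqrt (hσ i)
    have : a i * ψ i ^ 2 - 2 * √(σ i) * ψ i - (a i / 2 * ψ i ^ 2 - 2 * (√(σ i) ^ 2 / a i)) =
        (a i / 2) * (ψ i - 2 * √(σ i) / a i) ^ 2 := by
      field_simp
      ring
    rw [hs] at this
    have h2 : 0 ≤ (a i / 2) * (ψ i - 2 * √(σ i) / a i) ^ 2 := by positivity
    linarith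
  have h2 := (Finset.sum_le_sum fun i (_ : i ∈ Finset.univ) => h1 i).trans h
  rw [Finset.sum_sub_distrib, ← Finset.mul_sum] at h2
  have h3 : a t / 2 * ψ t ^ 2 ≤ ∑ i, a i / 2 * ψ i ^ 2 :=
    Finset.single_le_sum (f := fun i => a i / 2 * ψ i ^ 2)
      (fun i _ => by have := ha i; positivity) (Finset.mem_univ t)
  linarith

theorem IsQPSolution.mul_sq_le (h : IsQPSolution a σ φ) (ha : ∀ t, 0 < a t) (hσ : ∀ t, 0 ≤ σ t)
    (t : Fin m) : a t * φ t ^ 2 ≤ 4 * ∑ i, σ i / a i :=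
  mul_sq_le_of_qp_nonpos ha hσ (by
    simpa using h.2 (fun _ => 0) monotone_const fun _ => le_rfl) t

theorem exists_isQPSolution (ha : ∀ t, 0 < a t) (hσ : ∀ t, 0 ≤ σ t) :
    ∃ φ, IsQPSolution a σ φ := by
  let F : (Fin m → ℝ) → ℝ := fun ψ => ∑ t, (a t * ψ t ^ 2 - 2 * √(σ t) * ψ t)
  have hF : Continuous F := by fun_prop
  let C : Set (Fin m → ℝ) := {ψ | (Monotone ψ ∧ ∀ t, 0 ≤ ψ t) ∧ F ψ ≤ 0}
  have hclosed : IsClosed C := by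
    have h1 : IsClosed {ψ : Fin m → ℝ | Monotone ψ} := isClosed_monotone
    have h2 : IsClosed {ψ : Fin m → ℝ | ∀ t, 0 ≤ ψ t} := by
      simp only [Set.ofPred_forall]
      exact isClosed_iInter fun t => isClosed_le continuous_const (continuous_apply t)
    exact (h1.inter h2).inter (isClosed_le hF continuous_const)
  have hbdd : Bornology.IsBounded C := by
    refine (Metric.isBounded_Icc (0 : Fin m → ℝ)
      (fun t => √(4 * (∑ i, σ i / a i) / a t))).subset fun ψ hψ => ⟨hψ.1.2, fun t => ?_⟩
    refine Real.le_sqrt_of_sq_le ?_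
    rw [le_div_iff₀ (ha t), mul_comm]
    exact mul_sq_le_of_qp_nonpos ha hσ hψ.2 t
  have h0 : F 0 = 0 := by simp [F]
  obtain ⟨φ, hφ, hmin⟩ := (Metric.isCompact_of_isClosed_isBounded hclosed hbdd).exists_isMinOn
    ⟨0, ⟨monotone_const, fun _ => le_rfl⟩, h0.le⟩ hF.continuousOn
  refine ⟨φ, hφ.1, fun ψ h1 h2 => ?_⟩
  by_cases hψ : F ψ ≤ 0
  · exact hmin (show ψ ∈ C from ⟨⟨h1, h2⟩, hψ⟩)
  · exact hφ.2.trans (not_le.1 hψ).le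

end QuadraticProgram

/-! ### Lumped lengths and the majorization of the lengths by `√σ / φ`. -/

section Lumped

/-- The index of `{0, …, m - 1}` to which `lumped` assigns the length with index `k`. -/
def clamp {m : ℕ} (hm : 0 < m) (k : ℕ) : Fin m := ⟨min k (m - 1), by omega⟩

theorem clamp_monotone {m : ℕ} (hm : 0 < m) : Monotone (clamp hm) := fun i j hij => by
  simp only [clamp, Fin.mk_le_mk]
  omega

theorem clamp_val {m : ℕ} (hm : 0 < m) (i : Fin m) : clamp hm i = i := by
  ext
  simp only [clamp]
  omega

theorem lumped_eq {K m : ℕ} (hm : m ≤ K) (h0 : 0 < m) (ℓ : Fin K → ℝ) (i : Fin m) :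
    lumped hm ℓ i = ∑ k ∈ Finset.univ.filter (fun k : Fin K => clamp h0 k = i), ℓ k := by
  unfold lumped
  split_ifs with hi
  · rw [Finset.sum_eq_single (Fin.castLE hm i)]
    · intro k hk hne
      refine absurd ?_ hne
      have := (Finset.mem_filter.1 hk).2
      simp only [clamp, Fin.ext_iff] at this
      ext
      simp only [Fin.val_castLE]
      omega
    · intro hk
      refine absurd ?_ hk
      simp [clamp_val]
  · refine Finset.sum_congr (Finset.filter_congr fun k _ => ?_) fun _ _ => rfl
    simp only [clamp, Fin.ext_iff]
    omega

/-- Lumping is dual to extending a function on `Fin m` constantly beyond its last index. -/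
theorem sum_lumped_mul {K m : ℕ} (hm : m ≤ K) (h0 : 0 < m) (ℓ : Fin K → ℝ) (g : Fin m → ℝ) :
    ∑ t, lumped hm ℓ t * g t = ∑ k : Fin K, ℓ k * g (clamp h0 k) := by
  rw [← Finset.sum_fiberwise Finset.univ (fun k : Fin K => clamp h0 k)]
  refine Finset.sum_congr rfl fun t _ => ?_
  rw [lumped_eq hm h0, Finset.sum_mul]
  exact Finset.sum_congr rfl fun k hk => by rw [(Finset.mem_filter.1 hk).2]

theorem lumped_pos {K m : ℕ} (hm : m ≤ K) {ℓ : Fin K → ℝ} (hℓ : ∀ i, 0 < ℓ i) (i : Fin m) :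
    0 < lumped hm ℓ i := by
  rw [lumped_eq hm (i.pos) ℓ]
  refine Finset.sum_pos (fun k _ => hℓ k) ⟨Fin.castLE hm i, ?_⟩
  simp [clamp_val]

/-- The eigenvalues `√σ / φ`, padded by zeros, have partial sums at least those of `ℓ`, and the
same total. -/
theorem IsQPSolution.majorizes {K m : ℕ} (hm : m ≤ K) (h0 : 0 < m) {ℓ : Fin K → ℝ}
    (hℓ : ∀ i, 0 < ℓ i) {σ φ : Fin m → ℝ} (h : IsQPSolution (lumped hm ℓ) σ φ)
    (hσ : ∀ t, 0 < σ t) :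
    (∀ j : ℕ, ∑ k : Fin K with k.val < j, ℓ k ≤
      ∑ k : Fin K with k.val < j, if h : (k : ℕ) < m then √(σ ⟨k, h⟩) / φ ⟨k, h⟩ else 0) ∧
    ∑ k : Fin K, ℓ k = ∑ k : Fin K, if h : (k : ℕ) < m then √(σ ⟨k, h⟩) / φ ⟨k, h⟩ else 0 := by
  have htot : ∑ k, ℓ k = ∑ t, √(σ t) / φ t := by
    rw [h.sum_div hσ]
    simpa using (sum_lumped_mul hm h0 ℓ fun _ => 1).symm
  have hpart : ∀ j : ℕ, (∑ k : Fin K with k.val < j,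
      if h : (k : ℕ) < m then √(σ ⟨k, h⟩) / φ ⟨k, h⟩ else 0) =
      ∑ t with t.val < j, √(σ t) / φ t := by
    intro j
    rw [Finset.sum_filter, Finset.sum_filter]
    symm
    refine Finset.sum_of_injOn (Fin.castLE hm) (Fin.castLE_injective hm).injOn (by simp) ?_ ?_
    · intro k _ hk
      have : ¬ (k : ℕ) < m := fun hkm => hk ⟨⟨k, hkm⟩, by simp, rfl⟩
      simp [this]
    · intro t _
      simp
  have hall : ∀ {p j : ℕ} (f : Fin p → ℝ), p ≤ j → ∑ k with k.val < j, f k = ∑ k, f k := by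
    intro p j f hpj
    rw [Finset.filter_true_of_mem]
    intro k _
    omega
  constructor
  · intro j
    rw [hpart]
    by_cases hj : j < m
    · refine le_trans (le_of_eq ?_) (h.sum_le_sum_div hσ j)
      symm
      refine Finset.sum_of_injOn (Fin.castLE hm) (Fin.castLE_injective hm).injOn ?_ ?_ ?_
      · intro t ht
        simpa using ht
      · intro k hk hk'
        have hkj := (Finset.mem_filter.1 hk).2
        exact absurd ⟨⟨k, by omega⟩, by simpa using hkj, rfl⟩ hk'
      · intro t ht
        have := (Finset.mem_filter.1 ht).2
        rw [lumped, if_pos (by omega)]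
    -- From `j = m` on, the right side already equals the total of `ℓ`.
    · rw [hall _ (not_lt.1 hj), ← htot]
      exact Finset.sum_le_univ_sum_of_nonneg fun k => (hℓ k).le
  · rw [htot]
    have := hpart (max K m)
    rw [hall _ (le_max_left _ _), hall _ (le_max_right _ _)] at this
    exact this.symm

end Lumped

/-! ### Partial sums of sorted lists. -/

section SortedSums

/-- With threshold `c = L[k]`, any `k` entries sum to at most `k c` plus the total of the excesses
`max (x - c) 0`. That total is permutation invariant, and the first `k` entries of the sorted list
attain the bound. -/
theorem sum_take_le_of_perm {L L' : List ℝ} (hp : L'.Perm L) (hs : L.Pairwise fun x y => y ≤ x)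
    (k : ℕ) : (L'.take k).sum ≤ (L.take k).sum := by
  rcases le_or_gt L.length k with hk | hk
  · rw [List.take_of_length_le hk, List.take_of_length_le (hp.length_eq ▸ hk), hp.sum_eq]
  · have hup : ∀ (c : ℝ) (T : List ℝ), T.sum ≤ (T.map fun x => max (x - c) 0).sum + T.length * c := by
      intro c T
      induction T with
      | nil => simp
      | cons x T ih =>
        simp only [List.sum_cons, List.map_cons, List.length_cons]
        push_cast
        linarith [le_max_left (x - c) 0]
    have heq : ∀ (c : ℝ) (T : List ℝ), (∀ x ∈ T, c ≤ x) →
        T.sum = (T.map fun x => max (x - c) 0).sum + T.length * c := by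
      intro c T
      induction T with
      | nil => simp
      | cons x T ih =>
        intro h
        simp only [List.sum_cons, List.map_cons, List.length_cons]
        push_cast
        rw [ih fun y hy => h y (List.mem_cons_of_mem _ hy),
          max_eq_left (sub_nonneg.2 (h x List.mem_cons_self))]
        ring
    have hzero : ∀ (c : ℝ) (T : List ℝ), (∀ x ∈ T, x ≤ c) →
        (T.map fun x => max (x - c) 0).sum = 0 := by
      intro c T h
      refine List.sum_eq_zero fun y hy => ?_
      obtain ⟨x, hx, rfl⟩ := List.mem_map.1 hy
      exact max_eq_right (by linarith [h x hx])
    have hnn : ∀ (c : ℝ) (T : List ℝ), 0 ≤ (T.map fun x => max (x - c) 0).sum := by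
      intro c T
      refine List.sum_nonneg fun y hy => ?_
      obtain ⟨x, _, rfl⟩ := List.mem_map.1 hy
      exact le_max_right _ _
    set c := L[k]
    have hdrop : L.drop k = c :: L.drop (k + 1) := List.drop_eq_getElem_cons hk
    rw [← List.take_append_drop k L, List.pairwise_append, hdrop, List.pairwise_cons] at hs
    have h1 := hup c (L'.take k)
    have h2 := heq c (L.take k) fun x hx => hs.2.2 x hx c List.mem_cons_self
    have h3 : (L'.map fun x => max (x - c) 0).sum = (L.map fun x => max (x - c) 0).sum :=
      (hp.map _).sum_eq
    have h4 : ∀ T : List ℝ, (T.map fun x => max (x - c) 0).sum =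
        ((T.take k).map fun x => max (x - c) 0).sum +
          ((T.drop k).map fun x => max (x - c) 0).sum := by
      intro T
      rw [← List.sum_append, ← List.map_append, List.take_append_drop]
    have h5 : ((L.drop k).map fun x => max (x - c) 0).sum = 0 := by
      rw [hdrop]
      refine hzero c _ fun x hx => ?_
      rcases List.mem_cons.1 hx with rfl | hx
      · exact le_rfl
      · exact hs.2.1.1 x hx
    have h6 := hnn c (L'.drop k)
    have h7 : (L'.take k).length = (L.take k).length := by
      rw [List.length_take, List.length_take, hp.length_eq]
    rw [h4 L, h4 L', h5] at h3
    rw [h7] at h1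
    linarith

theorem exists_split_first {α : Type*} (p : α → Prop) (l : List α) (h : ∃ x ∈ l, p x) :
    ∃ pre w post, l = pre ++ w :: post ∧ (∀ x ∈ pre, ¬ p x) ∧ p w := by
  induction l with
  | nil => simp at h
  | cons y l ih =>
    by_cases hy : p y
    · exact ⟨[], y, l, rfl, by simp, hy⟩
    · obtain ⟨x, hx, hpx⟩ := h
      rcases List.mem_cons.1 hx with rfl | hx
      · exact absurd hpx hy
      · obtain ⟨pre, w, post, rfl, h1, h2⟩ := ih ⟨x, hx, hpx⟩
        exact ⟨y :: pre, w, post, rfl, List.forall_mem_cons.2 ⟨hy, h1⟩, h2⟩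

theorem nsmul_le_sum_of_le {T : List ℝ} {a : ℝ} (h : ∀ x ∈ T, a ≤ x) : T.length * a ≤ T.sum := by
  simpa using T.card_nsmul_le_sum a h

theorem sum_le_nsmul_of_le {T : List ℝ} {a : ℝ} (h : ∀ x ∈ T, x ≤ a) : T.sum ≤ T.length * a := by
  simpa using T.sum_le_card_nsmul a h

end SortedSums

/-! ### The rotation loop: invariants and termination with an output. -/

section Loop

variable {K : ℕ} {A : Matrix (Fin K) (Fin K) ℝ}

/-- A list of unit vectors that are pairwise orthogonal, also for the form `⟨x, A y⟩`. -/
structure DiagFamily (A : Matrix (Fin K) (Fin K) ℝ) (us : List (EuclideanSpace ℝ (Fin K))) :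
    Prop where
  pairwise : us.Pairwise fun x y => inner ℝ x y = 0 ∧ inner ℝ x (Matrix.toEuclideanLin A y) = 0
  norm_eq : ∀ u ∈ us, ‖u‖ = 1

theorem inner_toEuclideanLin_comm (hA : A.transpose = A) (x y : EuclideanSpace ℝ (Fin K)) :
    inner ℝ x (Matrix.toEuclideanLin A y) = inner ℝ y (Matrix.toEuclideanLin A x) := by
  rw [inner_toEuclideanLin_right, hA, real_inner_comm]

theorem DiagFamily.perm (hA : A.transpose = A) {us vs : List (EuclideanSpace ℝ (Fin K))}
    (h : DiagFamily A us) (hp : vs.Perm us) : DiagFamily A vs where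
  pairwise := (hp.pairwise_iff fun {x y} hxy => by
    rw [real_inner_comm, inner_toEuclideanLin_comm hA]; exact hxy).2 h.pairwise
  norm_eq u hu := h.norm_eq u (hp.subset hu)

theorem DiagFamily.tail {u : EuclideanSpace ℝ (Fin K)} {us : List (EuclideanSpace ℝ (Fin K))}
    (h : DiagFamily A (u :: us)) : DiagFamily A us where
  pairwise := (List.pairwise_cons.1 h.pairwise).2
  norm_eq v hv := h.norm_eq v (List.mem_cons_of_mem _ hv)

/-- The weights `Θ²` and `(1 - Θ)²` are in the ratio `(a - b') : (b - a)`, so the weighted mean of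
`b` and `b'` is `a`. The complementary vector receives the rest of the trace `b + b'`. -/
theorem theta_weights {a b b' Θ r : ℝ} (hb : a < b) (hb' : b' ≤ a) (hΘ : Θ = theta a b b')
    (hr : r = √(Θ ^ 2 + (1 - Θ) ^ 2)) :
    r⁻¹ ^ 2 * (Θ ^ 2 + (1 - Θ) ^ 2) = 1 ∧ r⁻¹ ^ 2 * (Θ ^ 2 * b + (1 - Θ) ^ 2 * b') = a ∧
      r⁻¹ ^ 2 * ((1 - Θ) ^ 2 * b + Θ ^ 2 * b') = b + b' - a := by
  have hN : 0 < Θ ^ 2 + (1 - Θ) ^ 2 := by nlinarith [sq_nonneg (2 * Θ - 1)]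
  have hr2 : r⁻¹ ^ 2 = (Θ ^ 2 + (1 - Θ) ^ 2)⁻¹ := by rw [inv_pow, hr, Real.sq_sqrt hN.le]
  have h1 : r⁻¹ ^ 2 * (Θ ^ 2 + (1 - Θ) ^ 2) = 1 := by rw [hr2, inv_mul_cancel₀ hN.ne']
  have h2 : r⁻¹ ^ 2 * (Θ ^ 2 * b + (1 - Θ) ^ 2 * b') = a := by
    rw [hr2, inv_mul_eq_iff_eq_mul₀ hN.ne', hΘ, theta]
    have hp := Real.sq_sqrt (sub_nonneg.2 hb')
    have hq := Real.sq_sqrt (sub_nonneg.2 hb.le)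
    have hq0 := Real.sqrt_pos.2 (sub_pos.2 hb)
    have hp0 := Real.sqrt_nonneg (a - b')
    set p := √(a - b')
    set q := √(b - a)
    have hpq : p + q ≠ 0 := by positivity
    have h1p : 1 - p / (p + q) = q / (p + q) := by field_simp; ring
    rw [h1p, div_pow, div_pow, hp, hq]
    field_simp
    ring
  exact ⟨h1, h2, by linear_combination (b + b') * h1 - h2⟩

theorem norm_smul_add_eq_one {x y : EuclideanSpace ℝ (Fin K)} {r α β : ℝ} (hx : ‖x‖ = 1)
    (hy : ‖y‖ = 1) (hxy : inner ℝ x y = 0) (h : r ^ 2 * (α ^ 2 + β ^ 2) = 1) :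
    ‖r • (α • x + β • y)‖ = 1 := by
  rw [← sq_eq_sq₀ (norm_nonneg _) zero_le_one, ← real_inner_self_eq_norm_sq]
  simp only [inner_smul_left, inner_smul_right, inner_add_left, inner_add_right, conj_trivial,
    real_inner_self_eq_norm_sq, hx, hy, hxy, real_inner_comm x y]
  linear_combination h

/-- One rotation of the orthonormal basis procedure. -/
theorem DiagFamily.rotate (hA : A.transpose = A) {u w : EuclideanSpace ℝ (Fin K)}
    {pre post : List (EuclideanSpace ℝ (Fin K))} (h : DiagFamily A (u :: (pre ++ w :: post)))
    {a Θ r : ℝ} (hu : a < quad A u) (hw : quad A w ≤ a)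
    (hΘ : Θ = theta a (quad A u) (quad A w)) (hr : r = √(Θ ^ 2 + (1 - Θ) ^ 2)) :
    DiagFamily A (r⁻¹ • ((1 - Θ) • u - Θ • w) :: (pre ++ post)) ∧
    ‖r⁻¹ • (Θ • u + (1 - Θ) • w)‖ = 1 ∧
    quad A (r⁻¹ • (Θ • u + (1 - Θ) • w)) = a ∧
    quad A (r⁻¹ • ((1 - Θ) • u - Θ • w)) = quad A u + quad A w - a ∧
    ∀ v ∈ r⁻¹ • ((1 - Θ) • u - Θ • w) :: (pre ++ post),
      inner ℝ (r⁻¹ • (Θ • u + (1 - Θ) • w)) v = 0 := by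
  have hp : (u :: w :: (pre ++ post)).Perm (u :: (pre ++ w :: post)) :=
    (List.perm_middle.symm).cons u
  have h' := h.perm hA hp
  obtain ⟨hpu, hpw, hrest⟩ : _ ∧ _ ∧ _ := by
    simpa only [List.pairwise_cons] using h'.pairwise
  obtain ⟨huw, hAuw⟩ := hpu w List.mem_cons_self
  have hAwu := (inner_toEuclideanLin_comm hA w u).trans hAuw
  have hnu := h'.norm_eq u List.mem_cons_self
  have hnw := h'.norm_eq w (List.mem_cons_of_mem _ List.mem_cons_self)
  obtain ⟨h1, h2, h3⟩ := theta_weights hu hw hΘ hr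
  have hsub : (1 - Θ) • u - Θ • w = (1 - Θ) • u + (-Θ) • w := by rw [neg_smul, sub_eq_add_neg]
  rw [hsub]
  refine ⟨⟨?_, ?_⟩, ?_, ?_, ?_, ?_⟩
  · refine List.pairwise_cons.2 ⟨fun v hv => ?_, hrest⟩
    obtain ⟨e1, e2⟩ := hpu v (List.mem_cons_of_mem _ hv)
    obtain ⟨e3, e4⟩ := hpw v hv
    simp [inner_smul_left, inner_add_left, e1, e2, e3, e4]
  · refine List.forall_mem_cons.2 ⟨norm_smul_add_eq_one hnu hnw huw ?_, fun v hv =>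
      h'.norm_eq v (List.mem_cons_of_mem _ (List.mem_cons_of_mem _ hv))⟩
    linear_combination h1
  · exact norm_smul_add_eq_one hnu hnw huw h1
  · rw [quad_smul_add A _ _ _ _ _ hAuw hAwu, h2]
  · rw [quad_smul_add A _ _ _ _ _ hAuw hAwu, neg_sq, h3]
  · refine List.forall_mem_cons.2 ⟨?_, fun v hv => ?_⟩
    · simp only [inner_smul_left, inner_smul_right, inner_add_left, inner_add_right, conj_trivial,
        real_inner_self_eq_norm_sq, hnu, hnw, huw, real_inner_comm u w]
      ring
    · simp [inner_smul_left, inner_add_left, (hpu v (List.mem_cons_of_mem _ hv)).1, (hpw v hv).1]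

/-- The last clause expresses that the outputs stay in the span of the current list. It is what
makes each emitted vector orthogonal to the later ones. -/
theorem OrthoLoop.spec (hA : A.transpose = A) {us xs : List (EuclideanSpace ℝ (Fin K))}
    {as : List ℝ} (h : OrthoLoop A us as xs) (hus : DiagFamily A us) :
    (xs.Pairwise fun x y => inner ℝ x y = 0) ∧ (∀ x ∈ xs, ‖x‖ = 1) ∧
      List.Forall₂ (fun x a => quad A x = a) xs as ∧
      ∀ y, (∀ u ∈ us, inner ℝ y u = 0) → ∀ x ∈ xs, inner ℝ y x = 0 := by
  induction h with
  | done => simp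
  | @case1 u us a as us' xs h hs hl ih =>
    obtain ⟨i1, i2, i3, i4⟩ := ih (hus.tail.perm hA hs.1)
    refine ⟨List.pairwise_cons.2 ⟨fun x hx => i4 u (fun v hv => ?_) x hx, i1⟩,
      List.forall_mem_cons.2 ⟨hus.norm_eq u List.mem_cons_self, i2⟩, .cons h i3, fun y hy => ?_⟩
    · exact ((List.pairwise_cons.1 hus.pairwise).1 v (hs.1.subset hv)).1
    · exact List.forall_mem_cons.2 ⟨hy u List.mem_cons_self,
        i4 y fun v hv => hy v (List.mem_cons_of_mem _ (hs.1.subset hv))⟩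
  | @case2 u pre w post a as us' xs h hw hp Θ r hΘ hr hs hl ih =>
    obtain ⟨r1, r2, r3, -, r5⟩ := hus.rotate hA h hw hΘ hr
    obtain ⟨i1, i2, i3, i4⟩ := ih (r1.perm hA hs.1)
    refine ⟨List.pairwise_cons.2 ⟨i4 _ fun v hv => r5 v (hs.1.subset hv), i1⟩,
      List.forall_mem_cons.2 ⟨r2, i2⟩, .cons r3 i3, fun y hy => ?_⟩
    have hyu := hy u List.mem_cons_self
    have hyw := hy w (by simp)
    refine List.forall_mem_cons.2 ⟨by simp [inner_smul_right, inner_add_right, hyu, hyw],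
      i4 y fun v hv => ?_⟩
    rcases List.mem_cons.1 (hs.1.subset hv) with rfl | hv
    · simp [inner_smul_right, inner_sub_right, hyu, hyw]
    · refine hy v ?_
      rcases List.mem_append.1 hv with hv | hv <;> simp [hv]

theorem exists_isSort (A : Matrix (Fin K) (Fin K) ℝ) (us : List (EuclideanSpace ℝ (Fin K))) :
    ∃ vs, IsSort A us vs := by
  classical
  let R : EuclideanSpace ℝ (Fin K) → EuclideanSpace ℝ (Fin K) → Prop :=
    fun x y => quad A y ≤ quad A x
  have : Std.Total R := ⟨fun x y => le_total _ _⟩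
  have : IsTrans _ R := ⟨fun _ _ _ hxy hyz => le_trans hyz hxy⟩
  exact ⟨us.insertionSort R, List.perm_insertionSort R us, List.pairwise_insertionSort R us⟩

/-- The constructive half of Schur–Horn: majorization of the remaining prescribed values by the
current values of the form is preserved by each step, and it provides the vector to rotate with. -/
theorem exists_orthoLoop (hA : A.transpose = A) (as : List ℝ) :
    ∀ us : List (EuclideanSpace ℝ (Fin K)), DiagFamily A us →
      (us.Pairwise fun x y => quad A y ≤ quad A x) → (as.Pairwise fun x y => y ≤ x) →
      us.length = as.length →
      (∀ k, (as.take k).sum ≤ ((us.map (quad A)).take k).sum) →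
      as.sum = (us.map (quad A)).sum → ∃ xs, OrthoLoop A us as xs := by
  induction as with
  | nil =>
    intro us _ _ _ hlen _ _
    rw [List.length_eq_zero_iff.1 hlen]
    exact ⟨_, .done⟩
  | cons a as ih =>
    intro us hus hsort has hlen hmaj htot
    obtain ⟨u, us, rfl⟩ := List.exists_cons_of_length_eq_add_one hlen
    obtain ⟨hale, has⟩ := List.pairwise_cons.1 has
    obtain ⟨hule, hsort'⟩ := List.pairwise_cons.1 hsort
    have hlen' : us.length = as.length := by simpa using hlen
    have hau : a ≤ quad A u := by simpa using hmaj 1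
    simp only [List.map_cons, List.sum_cons] at htot
    rcases hau.eq_or_lt with heq | hlt
    · obtain ⟨xs, hxs⟩ := ih us hus.tail hsort' has hlen' (fun k => by
        have := hmaj (k + 1)
        simp only [List.map_cons, List.take_succ_cons, List.sum_cons] at this
        linarith) (by linarith)
      exact ⟨_, .case1 heq.symm ⟨List.Perm.refl _, hsort'⟩ hxs⟩
    -- If every other value also exceeded `a`, the total would exceed that of the prescribed values,
    -- none of which is above `a`.
    · have hex : ∃ x ∈ us, quad A x ≤ a := by
        by_contra! hcon
        have h1 : us.length * a ≤ (us.map (quad A)).sum := by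
          simpa using nsmul_le_sum_of_le (T := us.map (quad A)) (a := a) (by
            intro y hy
            obtain ⟨x, hx, rfl⟩ := List.mem_map.1 hy
            exact (hcon x hx).le)
        have h2 := sum_le_nsmul_of_le hale
        rw [hlen'] at h1
        linarith
      obtain ⟨pre, w, post, rfl, hpre, hw⟩ := exists_split_first (fun x => quad A x ≤ a) us hex
      simp only [not_le] at hpre
      obtain ⟨r1, r2, r3, r4, r5⟩ := hus.rotate hA hlt hw rfl rfl
      obtain ⟨us', hs⟩ := exists_isSort A (_ :: (pre ++ post))
      have hperm := hs.1.map (quad A)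
      rw [List.map_cons, r4] at hperm
      have hpos' : ∀ k, (as.take k).sum ≤ ((us'.map (quad A)).take k).sum := by
        intro k
        have hsorted : (us'.map (quad A)).Pairwise fun x y => y ≤ x := List.pairwise_map.2 hs.2
        -- Sorting can only increase prefix sums, so it suffices to leave the new value in the place
        -- of `w`. Prefixes inside `pre` consist of values above `a`; longer ones are old prefix
        -- sums, one term longer, minus `a`.
        have hperm2 : ((pre.map (quad A)) ++ ((quad A u + quad A w - a) ::
            (post.map (quad A)))).Perm (us'.map (quad A)) := by
          refine (List.perm_middle.trans ?_).trans hperm.symm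
          rw [← List.map_append]
        refine le_trans ?_ (sum_take_le_of_perm hperm2 hsorted k)
        rcases le_or_gt k pre.length with hk | hk
        · rw [List.take_append_of_le_length (by simpa using hk)]
          have h1 := sum_le_nsmul_of_le (T := as.take k) (a := a)
            fun x hx => hale x (List.mem_of_mem_take hx)
          have h2 := nsmul_le_sum_of_le (T := (pre.map (quad A)).take k) (a := a) (by
            intro y hy
            obtain ⟨x, hx, rfl⟩ := List.mem_map.1 (List.mem_of_mem_take hy)
            exact (hpre x hx).le)
          have hl : (as.take k).length = ((pre.map (quad A)).take k).length := by
            simp only [List.length_take, List.length_map, List.length_append, List.length_cons]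
              at hlen' ⊢
            omega
          rw [hl] at h1
          exact h1.trans h2
        · obtain ⟨j, rfl⟩ := Nat.exists_eq_add_of_lt hk
          have h1 := hmaj (pre.length + j + 1 + 1)
          simp only [List.map_cons, List.map_append, List.take_succ_cons, List.sum_cons] at h1
          rw [show pre.length + j + 1 = (pre.map (quad A)).length + (j + 1) by simp; omega,
            List.take_length_add_append, List.take_succ_cons, List.sum_append, List.sum_cons] at h1 ⊢
          linarith
      obtain ⟨xs, hxs⟩ := ih us' (r1.perm hA hs.1) hs.2 has
        (by
          rw [hs.1.length_eq, ← hlen']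
          simp
          omega) hpos' (by
          rw [hperm.sum_eq]
          simp only [List.map_append, List.map_cons, List.sum_append, List.sum_cons] at htot ⊢
          linarith)
      refine ⟨_, .case2 hlt hw ?_ _ _ rfl rfl hs hxs⟩
      have hmem := List.getLast_mem (List.cons_ne_nil u pre)
      rcases List.mem_cons.1 hmem with h | h
      · rw [h]; exact hlt
      · exact hpre _ h

end Loop

/-! ### From orthonormal bases to dictionaries with prescribed lengths. -/

section RankOne

theorem sum_dite_val_lt {r K : ℕ} (hr : r ≤ K) (f : Fin r → ℝ) :
    ∑ k : Fin K, (if h : (k : ℕ) < r then f ⟨k, h⟩ else 0) = ∑ i, f i := by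
  symm
  refine Finset.sum_of_injOn (Fin.castLE hr) (Fin.castLE_injective hr).injOn (by simp) ?_ ?_
  · intro k _ hk
    have : ¬ (k : ℕ) < r := fun hkm => hk ⟨⟨k, hkm⟩, by simp, rfl⟩
    simp [this]
  · intro t _
    simp

theorem IsOrthoBasisOutput.spec {K : ℕ} {A : Matrix (Fin K) (Fin K) ℝ} (hA : A.transpose = A)
    {ℓ : Fin K → ℝ} {x : Fin K → EuclideanSpace ℝ (Fin K)} (h : IsOrthoBasisOutput A ℓ x) :
    Orthonormal ℝ x ∧ ∀ i, quad A (x i) = ℓ i := by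
  obtain ⟨e, us, he, heig, hs, hl⟩ := h
  have hAA : (1 / 2 : ℝ) • (A + A.transpose) = A := by
    rw [hA, ← two_smul ℝ A, smul_smul]
    norm_num
  rw [hAA] at heig
  have hdiag : DiagFamily A (List.ofFn e) := by
    refine ⟨List.pairwise_ofFn.2 fun i j hij => ⟨he.2 hij.ne, ?_⟩,
      List.forall_mem_ofFn_iff.2 he.1⟩
    obtain ⟨κ, hκ⟩ := heig j
    rw [hκ, inner_smul_right, he.2 hij.ne, mul_zero]
  obtain ⟨h1, h2, h3, -⟩ := hl.spec hA (hdiag.perm hA hs.1)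
  rw [List.pairwise_ofFn] at h1
  refine ⟨⟨List.forall_mem_ofFn_iff.1 h2, fun i j hij => ?_⟩, fun i => ?_⟩
  · rcases hij.lt_or_gt with hlt | hlt
    · exact h1 hlt
    · rw [real_inner_comm]
      exact h1 hlt
  · have := (List.forall₂_iff_get.1 h3).2 i (by simp) (by simp)
    simpa using this

theorem dictMatrix_transpose_mul_self {n m : ℕ} {x : Fin m → EuclideanSpace ℝ (Fin n)}
    (hx : Orthonormal ℝ x) : (dictMatrix x).transpose * dictMatrix x = 1 := by
  ext i j
  have h : ((dictMatrix x).transpose * dictMatrix x) i j = inner ℝ (x j) (x i) := by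
    simp [Matrix.mul_apply, dictMatrix, PiLp.inner_apply]
  rw [h, orthonormal_iff_ite.1 hx, Matrix.one_apply]
  simp [eq_comm]

/-- The matrix `(√κ₁ w₁ ⋯ √κᵣ wᵣ 0 ⋯ 0)`. -/
noncomputable def factorMat {n r : ℕ} (K : ℕ) (κ : Fin r → ℝ)
    (w : Fin r → EuclideanSpace ℝ (Fin n)) : Matrix (Fin n) (Fin K) ℝ :=
  Matrix.of fun (a : Fin n) (k : Fin K) =>
    if h : (k : ℕ) < r then √(κ ⟨k, h⟩) * w ⟨k, h⟩ a else 0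

/-- The matrix `diag(κ₁, …, κᵣ, 0, …, 0)`. -/
noncomputable def padDiag {r : ℕ} (K : ℕ) (κ : Fin r → ℝ) : Matrix (Fin K) (Fin K) ℝ :=
  Matrix.diagonal fun k : Fin K => if h : (k : ℕ) < r then κ ⟨k, h⟩ else 0

theorem padDiag_transpose {r : ℕ} (K : ℕ) (κ : Fin r → ℝ) :
    (padDiag K κ).transpose = padDiag K κ := Matrix.diagonal_transpose _

theorem factorMat_mul_transpose {n r K : ℕ} (hr : r ≤ K) {κ : Fin r → ℝ} (hκ : ∀ i, 0 < κ i)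
    (w : Fin r → EuclideanSpace ℝ (Fin n)) :
    factorMat K κ w * (factorMat K κ w).transpose = specMat κ w := by
  ext a b
  rw [Matrix.mul_apply, specMat_apply, ← sum_dite_val_lt hr]
  refine Finset.sum_congr rfl fun k _ => ?_
  simp only [factorMat, Matrix.of_apply, Matrix.transpose_apply]
  split_ifs with h
  · have := Real.mul_self_sqrt (hκ ⟨k, h⟩).le
    linear_combination (w ⟨k, h⟩ a * w ⟨k, h⟩ b) * this
  · simp

theorem factorMat_transpose_mul {n r K : ℕ} {κ : Fin r → ℝ} (hκ : ∀ i, 0 < κ i)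
    {w : Fin r → EuclideanSpace ℝ (Fin n)} (hw : Orthonormal ℝ w) :
    (factorMat K κ w).transpose * factorMat K κ w = padDiag K κ := by
  ext k k'
  rw [Matrix.mul_apply, padDiag, Matrix.diagonal_apply]
  simp only [factorMat, Matrix.of_apply, Matrix.transpose_apply]
  by_cases h : (k : ℕ) < r
  · by_cases h' : (k' : ℕ) < r
    · have h1 : ∑ a, √(κ ⟨k, h⟩) * w ⟨k, h⟩ a * (√(κ ⟨k', h'⟩) * w ⟨k', h'⟩ a) =
          √(κ ⟨k, h⟩) * √(κ ⟨k', h'⟩) * inner ℝ (w ⟨k, h⟩) (w ⟨k', h'⟩) := by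
        simp only [PiLp.inner_apply, RCLike.inner_apply, conj_trivial, Finset.mul_sum]
        exact Finset.sum_congr rfl fun a _ => by ring
      simp only [h, h', dite_true, h1]
      rw [orthonormal_iff_ite.1 hw]
      by_cases hk : k = k'
      · subst hk
        simpa using Real.mul_self_sqrt (hκ ⟨k, h⟩).le
      · have : (⟨k, h⟩ : Fin r) ≠ ⟨k', h'⟩ := fun e => hk (Fin.ext (Fin.mk.inj e))
        simp [hk, this]
    · have hk : k ≠ k' := fun e => h' (e ▸ h)
      simp [h', hk]
  · simp [h]

/-- The dictionary is `C X` with `X` orthogonal, so `D Dᵀ = C Cᵀ = M`, while `Cᵀ C = Λ` turns the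
lengths into the prescribed values `⟨xᵢ, Λ xᵢ⟩`. -/
theorem IsRankOneOutput.spec {n K : ℕ} {M : Matrix (Fin n) (Fin n) ℝ} (hM : M.transpose = M)
    {ℓ : Fin K → ℝ} {d : Fin K → EuclideanSpace ℝ (Fin n)} (h : IsRankOneOutput M ℓ d) :
    dictMatrix d * (dictMatrix d).transpose = M ∧ ∀ i, inner ℝ (d i) (d i) = ℓ i := by
  obtain ⟨r, hr, κ, w, x, heig, hx, hd⟩ := h
  change IsOrthoBasisOutput (padDiag K κ) ℓ x at hx
  change ∀ i, d i = Matrix.toEuclideanLin (factorMat K κ w) (x i) at hd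
  obtain ⟨hx1, hx2⟩ := hx.spec (padDiag_transpose K κ)
  have hD : dictMatrix d = factorMat K κ w * dictMatrix x := by
    ext a i
    simp [dictMatrix, hd, Matrix.toLpLin_apply, Matrix.mul_apply, Matrix.mulVec, dotProduct]
  constructor
  -- `X` is square, so orthonormal columns give orthonormal rows.
  · have hXX : dictMatrix x * (dictMatrix x).transpose = 1 :=
      mul_eq_one_comm.1 (dictMatrix_transpose_mul_self hx1)
    rw [hD, Matrix.transpose_mul, Matrix.mul_assoc, ← Matrix.mul_assoc (dictMatrix x), hXX,
      Matrix.one_mul, factorMat_mul_transpose hr heig.pos, ← heig.eq_specMat hM]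
  · intro i
    rw [hd, inner_toEuclideanLin_right, ← toEuclideanLin_mul_apply,
      factorMat_transpose_mul heig.pos heig.orthonormal, real_inner_comm, ← hx2 i]
    rfl

theorem toEuclideanLin_diagonal_single {K : ℕ} (c : Fin K → ℝ) (i : Fin K) :
    Matrix.toEuclideanLin (Matrix.diagonal c) (EuclideanSpace.single i 1) =
      c i • EuclideanSpace.single i (1 : ℝ) := by
  ext j
  simp only [Matrix.toLpLin_apply, PiLp.ofLp_single, Matrix.mulVec_diagonal, WithLp.ofLp_smul,
    Pi.smul_apply, smul_eq_mul, Pi.single_apply]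
  split_ifs with h
  · rw [h]
  · simp

theorem exists_isOrthoBasisOutput_diagonal {K : ℕ} {ℓ c : Fin K → ℝ} (hℓ : Antitone ℓ)
    (hc : Antitone c) (hmaj : ∀ j : ℕ, ∑ k : Fin K with k.val < j, ℓ k ≤
      ∑ k : Fin K with k.val < j, c k) (htot : ∑ k, ℓ k = ∑ k, c k) :
    ∃ x, IsOrthoBasisOutput (Matrix.diagonal c) ℓ x := by
  let e : Fin K → EuclideanSpace ℝ (Fin K) := fun i => EuclideanSpace.single i 1
  have he : Orthonormal ℝ e := EuclideanSpace.orthonormal_single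
  have hT : (Matrix.diagonal c).transpose = Matrix.diagonal c := Matrix.diagonal_transpose _
  have hquad : ∀ i, quad (Matrix.diagonal c) (e i) = c i := fun i => by
    rw [quad, toEuclideanLin_diagonal_single, inner_smul_right, real_inner_self_eq_norm_sq, he.1]
    simp
  have hdiag : DiagFamily (Matrix.diagonal c) (List.ofFn e) := by
    refine ⟨List.pairwise_ofFn.2 fun i j hij => ⟨he.2 hij.ne, ?_⟩,
      List.forall_mem_ofFn_iff.2 he.1⟩
    rw [toEuclideanLin_diagonal_single, inner_smul_right, he.2 hij.ne, mul_zero]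
  have hmap : (List.ofFn e).map (quad (Matrix.diagonal c)) = List.ofFn c := by
    rw [List.map_ofFn]
    congr 1
    funext i
    exact hquad i
  have hsorted : (List.ofFn e).Pairwise
      fun x y => quad (Matrix.diagonal c) y ≤ quad (Matrix.diagonal c) x :=
    List.pairwise_ofFn.2 fun i j hij => by rw [hquad, hquad]; exact hc hij.le
  obtain ⟨xs, hxs⟩ := exists_orthoLoop hT (List.ofFn ℓ) (List.ofFn e) hdiag hsorted
    (List.pairwise_ofFn.2 fun i j hij => hℓ hij.le) (by simp)
    (fun k => by rw [hmap, List.sum_take_ofFn, List.sum_take_ofFn]; exact hmaj k)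
    (by rw [hmap, List.sum_ofFn, List.sum_ofFn, htot])
  have hlen : xs.length = K := by
    have := (hxs.spec hT hdiag).2.2.1.length_eq
    simpa using this
  obtain ⟨x, rfl⟩ : ∃ x : Fin K → EuclideanSpace ℝ (Fin K), xs = List.ofFn x := by
    refine ⟨fun i => xs.get (Fin.cast hlen.symm i), ?_⟩
    conv_lhs => rw [← List.ofFn_get xs, List.ofFn_congr hlen]
  refine ⟨x, e, List.ofFn e, he, fun i => ⟨c i, ?_⟩, ⟨List.Perm.refl _, hsorted⟩, ?_⟩
  · rw [hT, ← two_smul ℝ (Matrix.diagonal c), smul_smul]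
    norm_num
    exact toEuclideanLin_diagonal_single c i
  · exact hxs

end RankOne

/-! ### What every output satisfies, and existence of an output. -/

section Algorithm

theorem rank_eq_zero_imp {p q : ℕ} {A : Matrix (Fin p) (Fin q) ℝ} (h : A.rank = 0) : A = 0 := by
  rw [rank_eq_finrank_range, Submodule.finrank_eq_zero, LinearMap.range_eq_bot] at h
  exact Matrix.toEuclideanLin.injective (h.trans (map_zero _).symm)

variable {n K : ℕ} {ℓ : Fin K → ℝ}

theorem IsAlgorithmOutput.spec {S : Matrix (Fin n) (Fin n) ℝ} (hS : S ≠ 0)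
    {d : Fin K → EuclideanSpace ℝ (Fin n)} (h : IsAlgorithmOutput ℓ S d) :
    0 < S.rank ∧ ∃ (hm : S.rank ≤ K) (σ : Fin S.rank → ℝ)
      (u : Fin S.rank → EuclideanSpace ℝ (Fin n)) (φ : Fin S.rank → ℝ),
      IsEigenDecomp S σ u ∧ IsQPSolution (lumped hm ℓ) σ φ ∧
      dictMatrix d * (dictMatrix d).transpose = specMat (fun t => √(σ t) / φ t) u ∧
      ∀ i, inner ℝ (d i) (d i) = ℓ i := by
  obtain ⟨m, hm, σ, u, φ, heig, hqp, hout⟩ := h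
  obtain rfl := heig.rank_eq
  refine ⟨Nat.pos_of_ne_zero fun h0 => hS (rank_eq_zero_imp h0), hm, σ, u, φ, heig, hqp, ?_⟩
  have hfun : eigvalMap (fun t => √(σ t)) (lumped hm ℓ) (breakpoints φ) =
      fun t => √(σ t) / φ t := funext fun t => hqp.eigvalMap_eq heig.pos t
  rw [hfun] at hout
  exact IsRankOneOutput.spec (specMat_transpose _ _) hout

/-- The eigendata and `φ` are prescribed, so that the value `∑ √σ φ` of any given data can later be
realized by a dictionary. -/
theorem exists_isAlgorithmOutput_of_data {S : Matrix (Fin n) (Fin n) ℝ} {m : ℕ} (h0 : 0 < m)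
    (hm : m ≤ K) (hℓ : ∀ i, 0 < ℓ i) (hanti : Antitone ℓ) {σ φ : Fin m → ℝ}
    {u : Fin m → EuclideanSpace ℝ (Fin n)} (heig : IsEigenDecomp S σ u)
    (hqp : IsQPSolution (lumped hm ℓ) σ φ) :
    ∃ d, IsRankOneOutput (specMat (fun t => √(σ t) / φ t) u) ℓ d ∧ IsAlgorithmOutput ℓ S d := by
  have hpos : ∀ t, 0 < √(σ t) / φ t := fun t =>
    div_pos (Real.sqrt_pos.2 (heig.pos t)) (hqp.pos heig.pos t)
  have hmono := antitone_sqrt_div hqp heig.pos heig.antitone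
  obtain ⟨hmaj, htot⟩ := hqp.majorizes hm h0 hℓ heig.pos
  obtain ⟨x, hx⟩ := exists_isOrthoBasisOutput_diagonal hanti
    (c := fun k : Fin K => if h : (k : ℕ) < m then √(σ ⟨k, h⟩) / φ ⟨k, h⟩ else 0) (by
      intro i j hij
      have hij' : (i : ℕ) ≤ j := hij
      dsimp only
      split_ifs with h1 h2 h2
      · exact hmono (show (⟨i, h2⟩ : Fin m) ≤ ⟨j, h1⟩ from hij)
      · omega
      · exact (hpos _).le
      · exact le_rfl) hmaj htot
  have hout : IsRankOneOutput (specMat (fun t => √(σ t) / φ t) u) ℓ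
      (fun i => Matrix.toEuclideanLin (factorMat K (fun t => √(σ t) / φ t) u) (x i)) :=
    ⟨m, hm, fun t => √(σ t) / φ t, u, x, isEigenDecomp_specMat heig.orthonormal hpos hmono, hx,
      fun _ => rfl⟩
  refine ⟨_, hout, m, hm, σ, u, φ, heig, hqp, ?_⟩
  have hfun : eigvalMap (fun t => √(σ t)) (lumped hm ℓ) (breakpoints φ) =
      fun t => √(σ t) / φ t := funext fun t => hqp.eigvalMap_eq heig.pos t
  rw [hfun]
  exact hout

theorem exists_isAlgorithmOutput (hnK : n ≤ K) (hℓ : ∀ i, 0 < ℓ i) (hanti : Antitone ℓ)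
    {S : Matrix (Fin n) (Fin n) ℝ} (hS : S.PosSemidef) (hS0 : S ≠ 0) :
    ∃ d, IsAlgorithmOutput ℓ S d := by
  obtain ⟨σ, u, heig⟩ := exists_isEigenDecomp hS
  have hm : S.rank ≤ K := (S.rank_le_height).trans hnK
  obtain ⟨φ, hqp⟩ := exists_isQPSolution (a := lumped hm ℓ) (σ := σ) (lumped_pos hm hℓ)
    fun t => (heig.pos t).le
  obtain ⟨d, -, hd⟩ := exists_isAlgorithmOutput_of_data
    (Nat.pos_of_ne_zero fun h0 => hS0 (rank_eq_zero_imp h0)) hm hℓ hanti heig hqp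
  exact ⟨d, hd⟩

end Algorithm

/-! ### The pseudo-inverse scheme in terms of `D Dᵀ`. -/

section PseudoInverse

variable {n m K : ℕ} {d : Fin K → EuclideanSpace ℝ (Fin n)} {c : Fin m → ℝ}
  {u : Fin m → EuclideanSpace ℝ (Fin n)}

/-- The projection `Q` onto the span of `u` fixes `D Dᵀ` from both sides, so `(Q D - D)(Q D - D)ᵀ =
0`. -/
theorem specMat_one_mul_of_mul_transpose (hu : Orthonormal ℝ u) {D : Matrix (Fin n) (Fin K) ℝ}
    (hD : D * D.transpose = specMat c u) : specMat (fun _ => 1) u * D = D := by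
  set Q := specMat (fun _ => 1) u with hQ
  have hQt : Q.transpose = Q := specMat_transpose _ _
  have h1 : Q * specMat c u = specMat c u := by rw [specMat_mul _ _ hu]; simp
  have h2 : specMat c u * Q = specMat c u := by rw [specMat_mul _ _ hu]; simp
  have h : (Q * D - D) * (Q * D - D).transpose = 0 := by
    rw [Matrix.transpose_sub, Matrix.transpose_mul, hQt, Matrix.sub_mul, Matrix.mul_sub,
      Matrix.mul_sub, ← Matrix.mul_assoc D, hD, h2, Matrix.mul_assoc Q, ← Matrix.mul_assoc D, hD,
      h2, Matrix.mul_assoc Q, hD, h1, sub_self]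
  refine sub_eq_zero.1 (Matrix.self_mul_conjTranspose_eq_zero.1 ?_)
  simpa using h

/-- This is `D⁺ = Dᵀ (D Dᵀ)⁺`, confirmed through the four Penrose conditions. -/
theorem pinv_eq (hu : Orthonormal ℝ u) (hc : ∀ i, c i ≠ 0) {D : Matrix (Fin n) (Fin K) ℝ}
    (hD : D * D.transpose = specMat c u) :
    pinv D = D.transpose * specMat (fun i => (c i)⁻¹) u := by
  have hNM : specMat c u * specMat (fun i => (c i)⁻¹) u = specMat (fun _ => 1) u := by
    rw [specMat_mul _ _ hu]
    simp only [mul_inv_cancel₀ (hc _)]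
  have hNQ : specMat (fun i => (c i)⁻¹) u * specMat (fun _ => 1) u =
      specMat (fun i => (c i)⁻¹) u := by
    rw [specMat_mul _ _ hu]
    simp
  refine (pinv_spec D).unique ⟨?_, ?_, ?_, ?_⟩
  · rw [← Matrix.mul_assoc, hD, hNM, specMat_one_mul_of_mul_transpose hu hD]
  · rw [Matrix.mul_assoc, ← Matrix.mul_assoc D, hD, hNM, Matrix.mul_assoc, hNQ]
  · rw [← Matrix.mul_assoc, hD, hNM, specMat_transpose]
  · simp [Matrix.transpose_mul, specMat_transpose, Matrix.mul_assoc]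

theorem norm_sq_scheme (hu : Orthonormal ℝ u) (hc : ∀ i, c i ≠ 0)
    (hD : dictMatrix d * (dictMatrix d).transpose = specMat c u)
    (x v : EuclideanSpace ℝ (Fin n)) :
    ‖scheme x d v‖ ^ 2 = ∑ i, (c i)⁻¹ * inner ℝ (u i) (v - x) ^ 2 := by
  rw [scheme, pinv_eq hu hc hD, ← real_inner_self_eq_norm_sq, inner_toEuclideanLin_right,
    ← toEuclideanLin_mul_apply, Matrix.transpose_mul, Matrix.transpose_transpose,
    specMat_transpose, Matrix.mul_assoc, ← Matrix.mul_assoc (dictMatrix d), hD, specMat_mul _ _ hu,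
    specMat_mul _ _ hu, real_inner_comm]
  have h1 : (fun i => (c i)⁻¹ * (c i * (c i)⁻¹)) = fun i => (c i)⁻¹ := by
    funext i
    rw [mul_inv_cancel₀ (hc i), mul_one]
  rw [h1]
  exact quad_specMat _ _ _

theorem sum_scheme_smul (x v : EuclideanSpace ℝ (Fin n)) (hu : Orthonormal ℝ u)
    (hc : ∀ i, c i ≠ 0) (hD : dictMatrix d * (dictMatrix d).transpose = specMat c u) :
    ∑ i, scheme x d v i • d i = ∑ i, (inner ℝ (u i) (v - x)) • u i := by
  have h1 : ∑ i, scheme x d v i • d i = Matrix.toEuclideanLin (dictMatrix d) (scheme x d v) := by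
    ext a
    simp [Matrix.toLpLin_apply, Matrix.mulVec, dotProduct, dictMatrix, mul_comm]
  rw [h1, scheme, ← toEuclideanLin_mul_apply, pinv_eq hu hc hD, ← Matrix.mul_assoc, hD,
    specMat_mul _ _ hu, toEuclideanLin_specMat]
  simp only [mul_inv_cancel₀ (hc _), one_mul]

theorem mem_span_of_mul_transpose (hc : ∀ i, c i ≠ 0) (hu : Orthonormal ℝ u)
    (hD : dictMatrix d * (dictMatrix d).transpose = specMat c u) (i : Fin m) :
    u i ∈ Submodule.span ℝ (Set.range d) := by
  have h := sum_scheme_smul 0 (u i) hu hc hD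
  rw [sub_zero, Finset.sum_eq_single i] at h
  · rw [real_inner_self_eq_norm_sq, hu.1 i, one_pow, one_smul] at h
    rw [← h]
    exact Submodule.sum_mem _ fun j _ => Submodule.smul_mem _ _ (Submodule.subset_span ⟨j, rfl⟩)
  · intro j _ hj
    rw [hu.2 hj, zero_smul]
  · simp

end PseudoInverse

/-! ### Second moments, the cost of a scheme, and its feasibility. -/

section Moments

variable {n : ℕ} {P : Measure (EuclideanSpace ℝ (Fin n))}

theorem memLp_inner (hP : MemLp id 2 P) (x : EuclideanSpace ℝ (Fin n)) :
    MemLp (fun v => inner ℝ x v) 2 P := hP.const_inner x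

theorem varMatrix_transpose : (varMatrix P).transpose = varMatrix P := by
  ext i j
  exact ProbabilityTheory.covariance_comm _ _

variable [IsProbabilityMeasure P]

theorem memLp_inner_sub (hP : MemLp id 2 P) (x c : EuclideanSpace ℝ (Fin n)) :
    MemLp (fun v => inner ℝ x (v - c)) 2 P := by
  simp only [inner_sub_right]
  exact (memLp_inner hP x).sub (memLp_const _)

theorem integrable_inner_sub_sq (hP : MemLp id 2 P) (x c : EuclideanSpace ℝ (Fin n)) :
    Integrable (fun v => inner ℝ x (v - c) ^ 2) P :=
  (memLp_inner_sub hP x c).integrable_sq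

theorem variance_inner (hP : MemLp id 2 P) (x : EuclideanSpace ℝ (Fin n)) :
    ProbabilityTheory.variance (fun v => inner ℝ x v) P = quad (varMatrix P) x := by
  have hcoord : ∀ i, MemLp (fun v : EuclideanSpace ℝ (Fin n) => v i) 2 P := by
    intro i
    simpa [EuclideanSpace.inner_single_left] using memLp_inner hP (EuclideanSpace.single i 1)
  have h1 : (fun v : EuclideanSpace ℝ (Fin n) => inner ℝ x v) = fun v => ∑ i, x i * v i := by
    funext v
    simp [PiLp.inner_apply, mul_comm]
  rw [← ProbabilityTheory.covariance_self (memLp_inner hP x).aestronglyMeasurable.aemeasurable, h1,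
    ProbabilityTheory.covariance_fun_sum_fun_sum (fun i => (hcoord i).const_mul _)
      (fun i => (hcoord i).const_mul _)]
  simp only [ProbabilityTheory.covariance_const_mul_left,
    ProbabilityTheory.covariance_const_mul_right, quad, PiLp.inner_apply, Matrix.toLpLin_apply,
    Matrix.mulVec, dotProduct, varMatrix, Matrix.of_apply, RCLike.inner_apply, conj_trivial,
    Finset.sum_mul]
  exact Finset.sum_congr rfl fun i _ => Finset.sum_congr rfl fun j _ => by ring

theorem integral_inner_sub_sq (hP : MemLp id 2 P) (x c : EuclideanSpace ℝ (Fin n)) :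
    ∫ v, inner ℝ x (v - c) ^ 2 ∂P = quad (varMatrix P) x + inner ℝ x (mean P - c) ^ 2 := by
  have h1 := ProbabilityTheory.variance_eq_sub (memLp_inner_sub hP x c)
  have hint : Integrable (fun v : EuclideanSpace ℝ (Fin n) => v) P :=
    hP.integrable (by norm_num)
  have h2 : ∫ v, inner ℝ x (v - c) ∂P = inner ℝ x (mean P - c) := by
    have hd : Integrable (fun v => v - c) P := hint.sub (integrable_const c)
    rw [integral_inner hd x,
      integral_sub hint (integrable_const c)]
    simp [mean]
  have h3 : ProbabilityTheory.variance (fun v => inner ℝ x (v - c)) P = quad (varMatrix P) x := by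
    simp only [inner_sub_right]
    rw [ProbabilityTheory.variance_sub_const (memLp_inner hP x).aestronglyMeasurable,
      variance_inner hP]
  rw [h3, h2] at h1
  simp only [Pi.pow_apply] at h1
  linarith

theorem quad_varMatrix_nonneg (hP : MemLp id 2 P) (x : EuclideanSpace ℝ (Fin n)) :
    0 ≤ quad (varMatrix P) x :=
  variance_inner hP x ▸ ProbabilityTheory.variance_nonneg _ _

theorem varMatrix_posSemidef (hP : MemLp id 2 P) : (varMatrix P).PosSemidef := by
  refine Matrix.PosSemidef.of_dotProduct_mulVec_nonneg ?_ fun x => ?_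
  · simpa [Matrix.IsHermitian] using varMatrix_transpose (P := P)
  · have := quad_varMatrix_nonneg hP (WithLp.toLp 2 x)
    rw [quad, EuclideanSpace.inner_eq_star_dotProduct] at this
    simpa [Matrix.toLpLin_apply, dotProduct_comm] using this

theorem enorm_sq_eq_ofReal {E : Type*} [NormedAddCommGroup E] (x : E) :
    ‖x‖ₑ ^ 2 = ENNReal.ofReal (‖x‖ ^ 2) := by
  rw [ENNReal.ofReal_pow (norm_nonneg x), ofReal_norm]

theorem lintegral_sum_inner_sq (hP : MemLp id 2 P) {m : ℕ} {c : Fin m → ℝ} (hc : ∀ i, 0 ≤ c i)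
    (u : Fin m → EuclideanSpace ℝ (Fin n)) (x : EuclideanSpace ℝ (Fin n)) :
    ∫⁻ v, ENNReal.ofReal (∑ i, c i * inner ℝ (u i) (v - x) ^ 2) ∂P =
      ENNReal.ofReal (∑ i, c i * (quad (varMatrix P) (u i) + inner ℝ (u i) (mean P - x) ^ 2)) := by
  rw [← ofReal_integral_eq_lintegral_ofReal]
  · rw [integral_finsetSum _ fun i _ => (integrable_inner_sub_sq hP (u i) x).const_mul _]
    simp only [integral_const_mul, integral_inner_sub_sq hP]
  · exact integrable_finsetSum _ fun i _ => (integrable_inner_sub_sq hP (u i) x).const_mul _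
  · exact Eventually.of_forall fun v =>
      Finset.sum_nonneg fun i _ => mul_nonneg (hc i) (sq_nonneg _)

theorem cost_scheme (hP : MemLp id 2 P) {m K : ℕ} {d : Fin K → EuclideanSpace ℝ (Fin n)}
    {c : Fin m → ℝ} {u : Fin m → EuclideanSpace ℝ (Fin n)} (hu : Orthonormal ℝ u)
    (hc : ∀ i, 0 < c i) (hD : dictMatrix d * (dictMatrix d).transpose = specMat c u)
    (x : EuclideanSpace ℝ (Fin n)) :
    cost P (scheme x d) = ENNReal.ofReal
      (∑ i, (c i)⁻¹ * (quad (varMatrix P) (u i) + inner ℝ (u i) (mean P - x) ^ 2)) := by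
  rw [← lintegral_sum_inner_sq hP fun i => (inv_pos.2 (hc i)).le, cost]
  simp only [enorm_sq_eq_ofReal, norm_sq_scheme hu (fun i => (hc i).ne') hD]

theorem ae_inner_sub_eq_zero (hP : MemLp id 2 P) {x : EuclideanSpace ℝ (Fin n)}
    (hx : quad (varMatrix P) x = 0) : ∀ᵐ v ∂P, inner ℝ x (v - mean P) = 0 := by
  have h := integral_inner_sub_sq hP x (mean P)
  rw [hx, sub_self, inner_zero_right, zero_pow two_ne_zero, add_zero,
    integral_eq_zero_iff_of_nonneg (fun v => sq_nonneg _) (integrable_inner_sub_sq hP x _)] at h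
  filter_upwards [h] with v hv
  simpa using hv

theorem quad_varMatrix_eq_zero (hP : MemLp id 2 P) {x c : EuclideanSpace ℝ (Fin n)}
    (h : ∀ᵐ v ∂P, inner ℝ x (v - c) = 0) : quad (varMatrix P) x = 0 := by
  have h1 := integral_inner_sub_sq hP x c
  rw [integral_eq_zero_of_ae (h.mono fun v hv => by simp [hv])] at h1
  have h2 := quad_varMatrix_nonneg hP x
  nlinarith [sq_nonneg (inner ℝ x (mean P - c))]

/-- Each basis vector minus its projection to the span of `u` has zero variance form, so `V - μ` is
almost surely orthogonal to it. -/
theorem ae_sub_mean_eq_sum (hP : MemLp id 2 P) {m : ℕ} {σ : Fin m → ℝ}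
    {u : Fin m → EuclideanSpace ℝ (Fin n)} (h : IsEigenDecomp (varMatrix P) σ u) :
    ∀ᵐ v ∂P, v - mean P = ∑ i, (inner ℝ (u i) (v - mean P)) • u i := by
  have hS := h.eq_specMat varMatrix_transpose
  have hcoord : ∀ a : Fin n, ∀ᵐ v ∂P, inner ℝ (EuclideanSpace.single a 1 -
      ∑ i, (inner ℝ (u i) (EuclideanSpace.single a (1 : ℝ))) • u i) (v - mean P) = 0 := by
    intro a
    refine ae_inner_sub_eq_zero hP ?_
    rw [hS, quad_specMat]
    simp only [inner_sub_proj h.orthonormal]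
    simp
  filter_upwards [ae_all_iff.2 hcoord] with v hv
  ext a
  have := hv a
  rw [inner_sub_left, sum_inner, sub_eq_zero] at this
  simp only [inner_smul_left, EuclideanSpace.inner_single_left, EuclideanSpace.inner_single_right,
    conj_trivial, one_mul] at this
  rw [this]
  simp [mul_comm]

theorem isFeasible_scheme (hP : MemLp id 2 P) {m K : ℕ} {ℓ : Fin K → ℝ}
    {d : Fin K → EuclideanSpace ℝ (Fin n)} {σ c : Fin m → ℝ}
    {u : Fin m → EuclideanSpace ℝ (Fin n)} (h : IsEigenDecomp (varMatrix P) σ u)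
    (hc : ∀ i, 0 < c i) (hD : dictMatrix d * (dictMatrix d).transpose = specMat c u)
    (hℓ : ∀ i, inner ℝ (d i) (d i) = ℓ i) :
    IsFeasible P ℓ (mean P) d (scheme (mean P) d) where
  lengths := hℓ
  span := by
    have hc' : ∀ i, c i ≠ 0 := fun i => (hc i).ne'
    set W := Submodule.span ℝ (Set.range d)
    -- A closed set of full measure contains the support; this upgrades the almost sure statement to
    -- every support point.
    have hcl : IsClosed {v : EuclideanSpace ℝ (Fin n) | v - mean P ∈ W} :=
      W.closed_of_finiteDimensional.preimage (by fun_prop)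
    have hae : ∀ᵐ v ∂P, v - mean P ∈ W := by
      filter_upwards [ae_sub_mean_eq_sum hP h] with v hv
      rw [hv]
      exact Submodule.sum_mem _ fun i _ => Submodule.smul_mem _ _
        (mem_span_of_mul_transpose hc' h.orthonormal hD i)
    intro v hv
    have := Measure.support_subset_of_isClosed hcl hae hv
    simpa using this
  measurable := by
    have : Continuous (scheme (mean P) d) :=
      (LinearMap.continuous_of_finiteDimensional _).comp (continuous_id.sub continuous_const)
    exact this.measurable
  represents := by
    filter_upwards [ae_sub_mean_eq_sum hP h] with v hv
    rw [sum_scheme_smul _ _ h.orthonormal (fun i => (hc i).ne') hD]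
    exact hv

end Moments

/-! ### A rearrangement inequality. -/

section Rearrangement

/-- Abel summation by induction. The free lower bound `c` is there so that the induction hypothesis
can be used with the last value of `s`. -/
theorem mul_sum_le_sum_mul_of_antitone {p : ℕ} : ∀ (s e : Fin p → ℝ), Antitone s →
    (∀ k ≤ p, 0 ≤ ∑ i : Fin p, if i.val < k then e i else 0) →
    ∀ c, 0 ≤ c → (∀ i, c ≤ s i) → c * ∑ i, e i ≤ ∑ i, s i * e i := by
  induction p with
  | zero => simp
  | succ p ih =>
    intro s e hs he c _ hcs
    have htot : 0 ≤ ∑ i, e i := by simpa [Fin.is_le] using he (p + 1) le_rfl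
    have h1 := ih (fun i => s i.castSucc) (fun i => e i.castSucc)
      (fun i j hij => hs (Fin.castSucc_le_castSucc_iff.2 hij)) (fun k hk => by
        have := he k (by omega)
        rw [Fin.sum_univ_castSucc] at this
        simpa [not_lt.2 hk] using this) (s (Fin.last p)) (by linarith [hcs (Fin.last p)])
      (fun i => hs (Fin.le_last _))
    have h2 := mul_le_mul_of_nonneg_right (hcs (Fin.last p)) htot
    rw [Fin.sum_univ_castSucc] at h2 ⊢
    rw [Fin.sum_univ_castSucc (fun i => s i * e i)]
    linarith

/-- A rearrangement inequality for matrices with row sums one and column sums at most one. -/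
theorem sum_mul_le_sum_mul_of_substochastic {p q : ℕ} {B : Fin p → Fin q → ℝ}
    (hB : ∀ i j, 0 ≤ B i j) (hrow : ∀ i, ∑ j, B i j = 1) (hcol : ∀ j, ∑ i, B i j ≤ 1)
    {s : Fin p → ℝ} (hs : Antitone s) (hs0 : ∀ i, 0 ≤ s i) {g : ℕ → ℝ} (hg : Monotone g) :
    ∑ i, s i * g i ≤ ∑ i, s i * ∑ j, B i j * g j := by
  have key := mul_sum_le_sum_mul_of_antitone s (fun i => ∑ j, B i j * g j - g i) hs
    (fun k hk => ?_) 0 le_rfl hs0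
  · simp only [mul_sub, Finset.sum_sub_distrib, zero_mul] at key
    linarith
  -- Row sums one allow centring at `g k`. The column sums over rows below `k` lie in `[0, 1]`, so
  -- nonpositive terms (`j < k`) count at most once and the nonnegative others can be dropped.
  · have h1 : ∀ i, (∑ j, B i j * g j - g i) = ∑ j, B i j * (g j - g k) - (g i - g k) := by
      intro i
      simp only [mul_sub, Finset.sum_sub_distrib, ← Finset.sum_mul, hrow]
      ring
    have h2 : (∑ i : Fin p, if i.val < k then (∑ j, B i j * g j - g i) else 0) =
        ∑ j, (∑ i : Fin p, if i.val < k then B i j else 0) * (g j - g k) -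
          ∑ i : Fin p, if i.val < k then g i - g k else 0 := by
      simp only [Finset.sum_mul, h1]
      rw [Finset.sum_comm, ← Finset.sum_sub_distrib]
      refine Finset.sum_congr rfl fun i _ => ?_
      split_ifs <;> simp
    have hβ0 : ∀ j, 0 ≤ ∑ i : Fin p, if i.val < k then B i j else 0 := fun j =>
      Finset.sum_nonneg fun i _ => by split_ifs; exacts [hB i j, le_rfl]
    have hβ1 : ∀ j, (∑ i : Fin p, if i.val < k then B i j else 0) ≤ 1 := fun j =>
      (Finset.sum_le_sum fun i _ => by split_ifs; exacts [le_rfl, hB i j]).trans (hcol j)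
    have h3 : ∀ r : ℕ, (∑ i : Fin r, if i.val < k then g i - g k else 0) =
        ∑ i ∈ Finset.range r, if i < k then g i - g k else 0 := fun r =>
      Fin.sum_univ_eq_sum_range (fun i => if i < k then g i - g k else 0) r
    have h4 : ∀ i : ℕ, (if i < k then g i - g k else 0) ≤ 0 := by
      intro i
      split_ifs with hi
      · linarith [hg hi.le]
      · exact le_rfl
    have h5 : (∑ i : Fin p, if i.val < k then g i - g k else 0) ≤
        ∑ j : Fin q, if j.val < k then g j - g k else 0 := by
      rw [h3, h3]
      have h6 : ∑ i ∈ Finset.range p, (if i < k then g i - g k else 0) =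
          ∑ i ∈ Finset.range k, if i < k then g i - g k else 0 := by
        refine (Finset.sum_subset (Finset.range_mono hk) fun i _ hi => ?_).symm
        rw [if_neg]
        simpa using hi
      rw [h6]
      rcases le_total k q with hkq | hkq
      · refine (Finset.sum_subset (Finset.range_mono hkq) fun i _ hi => ?_).le
        rw [if_neg]
        simpa using hi
      · rw [← neg_le_neg_iff, ← Finset.sum_neg_distrib, ← Finset.sum_neg_distrib]
        exact Finset.sum_le_sum_of_subset_of_nonneg (Finset.range_mono hkq) fun i _ _ => by
          linarith [h4 i]
    rw [h2, sub_nonneg]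
    refine h5.trans (Finset.sum_le_sum fun j _ => ?_)
    split_ifs with hj
    · have : g j ≤ g k := hg hj.le
      nlinarith [hβ1 j]
    · have : g k ≤ g j := hg (not_lt.1 hj)
      nlinarith [hβ0 j]

end Rearrangement

/-! ### Weak duality: the lower bound for all feasible triples, and optimality. -/

section LowerBound

variable {n K p m : ℕ}

theorem dictMatrix_mul_transpose (d : Fin K → EuclideanSpace ℝ (Fin n)) :
    dictMatrix d * (dictMatrix d).transpose = specMat (fun _ => 1) d := by
  ext a b
  simp [Matrix.mul_apply, specMat_apply, dictMatrix]

theorem toEuclideanLin_dictMatrix (d : Fin K → EuclideanSpace ℝ (Fin n))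
    (f : EuclideanSpace ℝ (Fin K)) :
    Matrix.toEuclideanLin (dictMatrix d) f = ∑ k, f k • d k := by
  ext a
  simp [Matrix.toLpLin_apply, Matrix.mulVec, dotProduct, dictMatrix, mul_comm]

/-- Right singular vectors of a dictionary matrix. -/
noncomputable def singularVec (d : Fin K → EuclideanSpace ℝ (Fin n)) (c : Fin p → ℝ)
    (v : Fin p → EuclideanSpace ℝ (Fin n)) (j : Fin p) : EuclideanSpace ℝ (Fin K) :=
  (√(c j))⁻¹ • Matrix.toEuclideanLin (dictMatrix d).transpose (v j)

variable {d : Fin K → EuclideanSpace ℝ (Fin n)} {c : Fin p → ℝ}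
  {v : Fin p → EuclideanSpace ℝ (Fin n)}

theorem orthonormal_singularVec (hv : Orthonormal ℝ v) (hc : ∀ j, 0 < c j)
    (hD : dictMatrix d * (dictMatrix d).transpose = specMat c v) :
    Orthonormal ℝ (singularVec d c v) := by
  rw [orthonormal_iff_ite]
  intro i j
  rw [singularVec, singularVec, inner_smul_left, inner_smul_right, real_inner_comm,
    inner_toEuclideanLin_right, Matrix.transpose_transpose, ← toEuclideanLin_mul_apply, hD,
    toEuclideanLin_specMat_self c hv, inner_smul_left, real_inner_comm,
    orthonormal_iff_ite.1 hv]
  split_ifs with h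
  · subst h
    have h1 := Real.mul_self_sqrt (hc i).le
    have h2 := (Real.sqrt_pos.2 (hc i)).ne'
    simp only [conj_trivial, mul_one]
    nth_rw 3 [← h1]
    field_simp
  · simp

/-- Together with Bessel's inequality this bounds `‖f‖²` below in terms of the represented vector `∑
fₖ dₖ` alone. -/
theorem inner_singularVec_sq (hc : ∀ j, 0 < c j) (f : EuclideanSpace ℝ (Fin K)) (j : Fin p) :
    inner ℝ (singularVec d c v j) f ^ 2 = (c j)⁻¹ * inner ℝ (v j) (∑ k, f k • d k) ^ 2 := by
  rw [singularVec, inner_smul_left, ← inner_toEuclideanLin_right, toEuclideanLin_dictMatrix,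
    mul_pow, conj_trivial, inv_pow, Real.sq_sqrt (hc j).le]

theorem sum_inner_sq_le {q : ℕ} {w : Fin p → EuclideanSpace ℝ (Fin q)} (hw : Orthonormal ℝ w)
    (x : EuclideanSpace ℝ (Fin q)) : ∑ j, inner ℝ (w j) x ^ 2 ≤ ‖x‖ ^ 2 := by
  simpa using hw.sum_inner_products_le (s := Finset.univ) x

/-- With `X = ∑ √σᵢ φᵢ`, summing `τⱼ² / cⱼ ≥ 2 gⱼ τⱼ - cⱼ gⱼ²` gives at least `2X - X`, since `∑ gⱼ
τⱼ ≥ X` and `∑ cⱼ gⱼ² ≤ X`. The last hypothesis says that every `uᵢ` lies in the span of `v`. -/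
theorem sum_mul_sqrt_le_sum_quad_div (hm : m ≤ K) (h0 : 0 < m) {ℓ : Fin K → ℝ}
    {σ φ : Fin m → ℝ} {u : Fin m → EuclideanSpace ℝ (Fin n)} (hσ : ∀ i, 0 < σ i)
    (hanti : Antitone σ) (hu : Orthonormal ℝ u) (hqp : IsQPSolution (lumped hm ℓ) σ φ)
    (hv : Orthonormal ℝ v) (hc : ∀ j, 0 < c j) (hca : Antitone c)
    (hD : dictMatrix d * (dictMatrix d).transpose = specMat c v)
    (hℓ : ∀ k, inner ℝ (d k) (d k) = ℓ k) (huv : ∀ i, ∑ j, inner ℝ (v j) (u i) ^ 2 = 1) :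
    ∑ i, √(σ i) * φ i ≤ ∑ j, (c j)⁻¹ * quad (specMat σ u) (v j) := by
  set g : ℕ → ℝ := fun k => φ (clamp h0 k) with hg
  have hgm : Monotone g := hqp.1.1.comp (clamp_monotone h0)
  have hg0 : ∀ k, 0 ≤ g k := fun k => hqp.1.2 _
  have hgφ : ∀ i : Fin m, g i = φ i := fun i => by rw [hg]; simp only [clamp_val]
  set τ : Fin p → ℝ := fun j => √(quad (specMat σ u) (v j)) with hτ
  have hquad0 : ∀ j, 0 ≤ quad (specMat σ u) (v j) := fun j => by
    rw [quad_specMat]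
    exact Finset.sum_nonneg fun i _ => mul_nonneg (hσ i).le (sq_nonneg _)
  -- Rearrangement with the weights `⟨vⱼ, uᵢ⟩²`; Cauchy–Schwarz then bounds `∑ᵢ √σᵢ ⟨vⱼ, uᵢ⟩²` by
  -- `τⱼ`.
  have h1 : ∑ i, √(σ i) * φ i ≤ ∑ j : Fin p, g j * τ j := by
    have hB := sum_mul_le_sum_mul_of_substochastic (B := fun i j => inner ℝ (v j) (u i) ^ 2)
      (s := fun i => √(σ i)) (fun i j => sq_nonneg _) huv (fun j => by
        have := sum_inner_sq_le hu (v j)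
        rw [hv.1 j] at this
        simpa only [real_inner_comm, one_pow] using this)
      (fun i j hij => Real.sqrt_le_sqrt (hanti hij)) (fun i => Real.sqrt_nonneg _) hgm
    simp only [hgφ] at hB
    refine hB.trans ?_
    simp only [Finset.mul_sum]
    rw [Finset.sum_comm]
    refine Finset.sum_le_sum fun j _ => ?_
    have h2 : ∑ i, √(σ i) * inner ℝ (v j) (u i) ^ 2 ≤ τ j := by
      refine Real.le_sqrt_of_sq_le ?_
      have h3 := Finset.sum_mul_sq_le_sq_mul_sq Finset.univ (fun i => inner ℝ (u i) (v j))
        (fun i => √(σ i) * inner ℝ (u i) (v j))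
      have h4 : ∑ i, √(σ i) * inner ℝ (v j) (u i) ^ 2 =
          ∑ i, inner ℝ (u i) (v j) * (√(σ i) * inner ℝ (u i) (v j)) :=
        Finset.sum_congr rfl fun i _ => by rw [real_inner_comm]; ring
      have h5 : ∑ i, (√(σ i) * inner ℝ (u i) (v j)) ^ 2 = quad (specMat σ u) (v j) := by
        rw [quad_specMat]
        exact Finset.sum_congr rfl fun i _ => by rw [mul_pow, Real.sq_sqrt (hσ i).le]
      have h6 : ∑ i, inner ℝ (u i) (v j) ^ 2 ≤ 1 := by
        have := sum_inner_sq_le hu (v j)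
        rwa [hv.1 j, one_pow] at this
      rw [h4]
      rw [h5] at h3
      nlinarith [hquad0 j]
    calc ∑ i, √(σ i) * (inner ℝ (v j) (u i) ^ 2 * g j)
        = g j * ∑ i, √(σ i) * inner ℝ (v j) (u i) ^ 2 := by
          rw [Finset.mul_sum]
          exact Finset.sum_congr rfl fun i _ => by ring
      _ ≤ g j * τ j := mul_le_mul_of_nonneg_left h2 (hg0 j)
  -- Rearrangement with the weights `cⱼ⁻¹ ⟨dₖ, vⱼ⟩²`, the squared entries of the right singular
  -- vectors. It leads to `∑ ℓₖ gₖ²`, which is `∑ ℓ'ₜ φₜ²` by lumping.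
  have h2 : ∑ j, c j * g j ^ 2 ≤ ∑ i, √(σ i) * φ i := by
    have hW := sum_mul_le_sum_mul_of_substochastic
      (B := fun j k => (c j)⁻¹ * inner ℝ (d k) (v j) ^ 2) (s := c) (g := fun k => g k ^ 2)
      (fun j k => mul_nonneg (inv_pos.2 (hc j)).le (sq_nonneg _)) (fun j => by
        have h3 : quad (specMat c v) (v j) = ∑ k, inner ℝ (d k) (v j) ^ 2 := by
          rw [← hD, dictMatrix_mul_transpose, quad_specMat]
          simp
        rw [← Finset.mul_sum, ← h3, quad, toEuclideanLin_specMat_self c hv, inner_smul_right,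
          real_inner_self_eq_norm_sq, hv.1 j, one_pow, mul_one, inv_mul_cancel₀ (hc j).ne'])
      (fun k => by
        have h3 := sum_inner_sq_le (orthonormal_singularVec hv hc hD) (EuclideanSpace.single k 1)
        simp only [inner_singularVec_sq hc] at h3
        have h4 : ∑ k', (EuclideanSpace.single k (1 : ℝ)) k' • d k' = d k := by
          simp
        rw [h4] at h3
        simpa [real_inner_comm] using h3)
      hca (fun j => (hc j).le) (fun a b hab => by
        have := hgm hab
        have := hg0 a
        dsimp only
        gcongr)
    refine hW.trans ?_
    rw [← hqp.sum_sq hσ, sum_lumped_mul hm h0 ℓ fun t => φ t ^ 2]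
    simp only [Finset.mul_sum]
    rw [Finset.sum_comm]
    refine Finset.sum_le_sum fun k _ => ?_
    calc ∑ j, c j * ((c j)⁻¹ * inner ℝ (d k) (v j) ^ 2 * g k ^ 2)
        = (∑ j, inner ℝ (v j) (d k) ^ 2) * g k ^ 2 := by
          rw [Finset.sum_mul]
          refine Finset.sum_congr rfl fun j _ => ?_
          have := (hc j).ne'
          rw [real_inner_comm]
          field_simp
      _ ≤ ℓ k * g k ^ 2 := by
          refine mul_le_mul_of_nonneg_right ?_ (sq_nonneg _)
          rw [← hℓ k, real_inner_self_eq_norm_sq]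
          exact sum_inner_sq_le hv (d k)
  have h3 : ∀ j : Fin p, 2 * (g j * τ j) - c j * g j ^ 2 ≤ (c j)⁻¹ * quad (specMat σ u) (v j) := by
    intro j
    have h4 : τ j ^ 2 = quad (specMat σ u) (v j) := Real.sq_sqrt (hquad0 j)
    have h5 : (c j)⁻¹ * τ j ^ 2 - (2 * (g j * τ j) - c j * g j ^ 2) =
        (c j)⁻¹ * (τ j - c j * g j) ^ 2 := by
      have := (hc j).ne'
      field_simp
      ring
    rw [← h4]
    have := mul_nonneg (inv_pos.2 (hc j)).le (sq_nonneg (τ j - c j * g j))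
    linarith
  have h4 := Finset.sum_le_sum fun j (_ : j ∈ Finset.univ) => h3 j
  rw [Finset.sum_sub_distrib, ← Finset.mul_sum] at h4
  linarith

theorem IsEigenDecomp.quad_eq {S : Matrix (Fin n) (Fin n) ℝ} {σ : Fin m → ℝ}
    {u : Fin m → EuclideanSpace ℝ (Fin n)} (h : IsEigenDecomp S σ u) (i : Fin m) :
    quad S (u i) = σ i := by
  rw [quad, h.eigen, inner_smul_right, real_inner_self_eq_norm_sq, h.orthonormal.1 i, one_pow,
    mul_one]

variable {P : Measure (EuclideanSpace ℝ (Fin n))} [IsProbabilityMeasure P]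

theorem le_cost_of_isFeasible (hP : MemLp id 2 P) (hm : m ≤ K) (h0 : 0 < m) {ℓ : Fin K → ℝ}
    {σ φ : Fin m → ℝ} {u : Fin m → EuclideanSpace ℝ (Fin n)}
    (h : IsEigenDecomp (varMatrix P) σ u) (hqp : IsQPSolution (lumped hm ℓ) σ φ)
    {x : EuclideanSpace ℝ (Fin n)} {d : Fin K → EuclideanSpace ℝ (Fin n)}
    {f : EuclideanSpace ℝ (Fin n) → EuclideanSpace ℝ (Fin K)} (hf : IsFeasible P ℓ x d f) :
    ENNReal.ofReal (∑ i, √(σ i) * φ i) ≤ cost P f := by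
  have hpsd : (dictMatrix d * (dictMatrix d).transpose).PosSemidef := by
    simpa using Matrix.posSemidef_self_mul_conjTranspose (dictMatrix d)
  obtain ⟨c, v, heig⟩ := exists_isEigenDecomp hpsd
  have hD := heig.eq_specMat (by simp)
  have hS := h.eq_specMat varMatrix_transpose
  -- The residual `y` of `uᵢ` off the span of `v` is orthogonal to every `dₖ`. Feasibility then
  -- makes `⟨y, V - x⟩` vanish almost surely, so `y` has zero variance form and is orthogonal to
  -- `uᵢ`.
  have huv : ∀ i, ∑ j, inner ℝ (v j) (u i) ^ 2 = 1 := by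
    intro i
    set y := u i - ∑ j, (inner ℝ (v j) (u i)) • v j with hy
    have h1 : ∑ k, inner ℝ (d k) y ^ 2 = 0 := by
      have h2 : quad (specMat c v) y = ∑ k, inner ℝ (d k) y ^ 2 := by
        rw [← hD, dictMatrix_mul_transpose, quad_specMat]
        simp
      rw [← h2, quad_specMat]
      simp only [hy, inner_sub_proj heig.orthonormal]
      simp
    have h2 : ∀ k, inner ℝ (d k) y = 0 := fun k => by
      have := (Finset.sum_eq_zero_iff_of_nonneg fun k _ => sq_nonneg _).1 h1 k (Finset.mem_univ k)
      exact pow_eq_zero_iff two_ne_zero |>.1 this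
    have h3 : quad (varMatrix P) y = 0 := by
      refine quad_varMatrix_eq_zero hP (c := x) ?_
      filter_upwards [hf.represents] with w hw
      rw [hw, inner_sum]
      refine Finset.sum_eq_zero fun k _ => ?_
      rw [inner_smul_right, real_inner_comm, h2, mul_zero]
    rw [hS, quad_specMat] at h3
    have h4 := (Finset.sum_eq_zero_iff_of_nonneg
      fun k _ => mul_nonneg (h.pos k).le (sq_nonneg _)).1 h3 i (Finset.mem_univ i)
    have h5 : inner ℝ (u i) y = 0 := by
      rcases mul_eq_zero.1 h4 with h6 | h6
      · exact absurd h6 (h.pos i).ne'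
      · exact pow_eq_zero_iff two_ne_zero |>.1 h6
    rw [hy, inner_sub_right, real_inner_self_eq_norm_sq, h.orthonormal.1 i, inner_sum,
      sub_eq_zero] at h5
    rw [one_pow] at h5
    rw [h5]
    refine Finset.sum_congr rfl fun j _ => ?_
    rw [inner_smul_right, real_inner_comm (v j) (u i), sq]
  have hmain := sum_mul_sqrt_le_sum_quad_div hm h0 h.pos h.antitone h.orthonormal hqp
    heig.orthonormal heig.pos heig.antitone hD hf.lengths huv
  calc ENNReal.ofReal (∑ i, √(σ i) * φ i)
      ≤ ENNReal.ofReal (∑ j, (c j)⁻¹ *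
          (quad (varMatrix P) (v j) + inner ℝ (v j) (mean P - x) ^ 2)) := by
        refine ENNReal.ofReal_le_ofReal (hmain.trans (Finset.sum_le_sum fun j _ => ?_))
        rw [← hS]
        -- A constant other than the mean only adds a nonnegative bias term.
        exact mul_le_mul_of_nonneg_left (le_add_of_nonneg_right (sq_nonneg _))
          (inv_pos.2 (heig.pos j)).le
    _ = ∫⁻ w, ENNReal.ofReal (∑ j, (c j)⁻¹ * inner ℝ (v j) (w - x) ^ 2) ∂P :=
        (lintegral_sum_inner_sq hP (fun j => (inv_pos.2 (heig.pos j)).le) v x).symm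
    _ ≤ cost P f := by
        refine lintegral_mono_ae ?_
        filter_upwards [hf.represents] with w hw
        rw [enorm_sq_eq_ofReal, hw]
        refine ENNReal.ofReal_le_ofReal ?_
        simp only [← inner_singularVec_sq heig.pos]
        exact sum_inner_sq_le (orthonormal_singularVec heig.orthonormal heig.pos hD) (f w)

theorem cost_scheme_mean (hP : MemLp id 2 P) {a σ φ : Fin m → ℝ}
    {u : Fin m → EuclideanSpace ℝ (Fin n)} (h : IsEigenDecomp (varMatrix P) σ u)
    (hqp : IsQPSolution a σ φ) {d : Fin K → EuclideanSpace ℝ (Fin n)}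
    (hD : dictMatrix d * (dictMatrix d).transpose = specMat (fun t => √(σ t) / φ t) u) :
    cost P (scheme (mean P) d) = ENNReal.ofReal (∑ i, √(σ i) * φ i) := by
  rw [cost_scheme hP h.orthonormal (fun t =>
    div_pos (Real.sqrt_pos.2 (h.pos t)) (hqp.pos h.pos t)) hD]
  congr 1
  refine Finset.sum_congr rfl fun i _ => ?_
  have h2 := Real.mul_self_sqrt (h.pos i).le
  have h3 := (Real.sqrt_pos.2 (h.pos i)).ne'
  rw [h.quad_eq, sub_self, inner_zero_right, zero_pow two_ne_zero, add_zero, inv_div]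
  nth_rw 2 [← h2]
  field_simp

theorem isOptimal_scheme (hP : MemLp id 2 P) (hm : m ≤ K) (h0 : 0 < m) {ℓ : Fin K → ℝ}
    {σ φ : Fin m → ℝ} {u : Fin m → EuclideanSpace ℝ (Fin n)}
    (h : IsEigenDecomp (varMatrix P) σ u) (hqp : IsQPSolution (lumped hm ℓ) σ φ)
    {d : Fin K → EuclideanSpace ℝ (Fin n)}
    (hD : dictMatrix d * (dictMatrix d).transpose = specMat (fun t => √(σ t) / φ t) u)
    (hℓ : ∀ i, inner ℝ (d i) (d i) = ℓ i) :
    IsOptimal P ℓ (mean P) d (scheme (mean P) d) :=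
  ⟨isFeasible_scheme hP h (fun t => div_pos (Real.sqrt_pos.2 (h.pos t)) (hqp.pos h.pos t)) hD hℓ,
    fun _ _ _ hf => cost_scheme_mean hP h hqp hD ▸ le_cost_of_isFeasible hP hm h0 h hqp hf⟩

/-- The optimal cost does not depend on the eigenvectors and the solution of the quadratic
program. -/
theorem sum_sqrt_mul_eq (hP : MemLp id 2 P) (hm : m ≤ K) (h0 : 0 < m) {ℓ : Fin K → ℝ}
    (hℓ : ∀ i, 0 < ℓ i) (hanti : Antitone ℓ)
    {σ φ σ' φ' : Fin m → ℝ} {u u' : Fin m → EuclideanSpace ℝ (Fin n)}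
    (h : IsEigenDecomp (varMatrix P) σ u) (hqp : IsQPSolution (lumped hm ℓ) σ φ)
    (h' : IsEigenDecomp (varMatrix P) σ' u') (hqp' : IsQPSolution (lumped hm ℓ) σ' φ') :
    ENNReal.ofReal (∑ i, √(σ i) * φ i) = ENNReal.ofReal (∑ i, √(σ' i) * φ' i) := by
  have hex : ∀ {σ φ : Fin m → ℝ} {u : Fin m → EuclideanSpace ℝ (Fin n)},
      IsEigenDecomp (varMatrix P) σ u → IsQPSolution (lumped hm ℓ) σ φ →
      ∃ d, IsFeasible P ℓ (mean P) d (scheme (mean P) d) ∧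
        cost P (scheme (mean P) d) = ENNReal.ofReal (∑ i, √(σ i) * φ i) := by
    intro σ φ u h hqp
    obtain ⟨d, hd, -⟩ := exists_isAlgorithmOutput_of_data h0 hm hℓ hanti h hqp
    obtain ⟨hD, hl⟩ := hd.spec (specMat_transpose _ _)
    exact ⟨d, (isOptimal_scheme hP hm h0 h hqp hD hl).1, cost_scheme_mean hP h hqp hD⟩
  obtain ⟨d, hd, hcost⟩ := hex h hqp
  obtain ⟨d', hd', hcost'⟩ := hex h' hqp'
  -- Each value is attained by a feasible triple and bounds all feasible costs from below.
  exact le_antisymm (hcost' ▸ le_cost_of_isFeasible hP hm h0 h hqp hd')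
    (hcost ▸ le_cost_of_isFeasible hP hm h0 h' hqp' hd)

end LowerBound

/-! ### Continuity of the cost at the true mean and variance. -/

section Limit

variable {n m : ℕ}

theorem trace_specMat {c : Fin m → ℝ} {u : Fin m → EuclideanSpace ℝ (Fin n)}
    (hu : Orthonormal ℝ u) : (specMat c u).trace = ∑ i, c i := by
  simp only [Matrix.trace, Matrix.diag_apply, specMat_apply]
  rw [Finset.sum_comm]
  refine Finset.sum_congr rfl fun i _ => ?_
  have h : ∑ a, u i a * u i a = 1 := by
    have := real_inner_self_eq_norm_sq (u i)
    rw [hu.1 i, one_pow] at this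
    simpa only [PiLp.inner_apply, RCLike.inner_apply, conj_trivial] using this
  rw [← Finset.mul_sum, h, mul_one]

theorem rank_specMat_lt {c : Fin m → ℝ} (u : Fin m → EuclideanSpace ℝ (Fin n)) {i : Fin m}
    (hi : c i = 0) : (specMat c u).rank < m := by
  classical
  have hle : LinearMap.range (Matrix.toEuclideanLin (specMat c u)) ≤
      Submodule.span ℝ (((Finset.univ.erase i).image u : Finset _) : Set _) := by
    rintro _ ⟨x, rfl⟩
    rw [toEuclideanLin_specMat]
    refine Submodule.sum_mem _ fun j _ => ?_
    by_cases hj : j = i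
    · rw [hj, hi, zero_mul, zero_smul]
      exact Submodule.zero_mem _
    · exact Submodule.smul_mem _ _ (Submodule.subset_span (by
        simp only [Finset.coe_image, Set.mem_image, Finset.mem_coe, Finset.mem_erase,
          Finset.mem_univ, and_true]
        exact ⟨j, hj, rfl⟩))
  calc (specMat c u).rank ≤ _ := (rank_eq_finrank_range _).trans_le (Submodule.finrank_mono hle)
    _ ≤ ((Finset.univ.erase i).image u).card := finrank_span_finset_le_card _
    _ ≤ (Finset.univ.erase i).card := Finset.card_image_le
    _ < m := by
      have := i.pos
      simp
      omega

/-- A convergent limit of eigendecompositions at constant rank is an eigendecomposition. -/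
theorem isEigenDecomp_of_tendsto {ι : Type*} {l : Filter ι} [l.NeBot]
    {S : ι → Matrix (Fin n) (Fin n) ℝ} {T : Matrix (Fin n) (Fin n) ℝ} {σ : ι → Fin m → ℝ}
    {u : ι → Fin m → EuclideanSpace ℝ (Fin n)} {σ₀ : Fin m → ℝ}
    {u₀ : Fin m → EuclideanSpace ℝ (Fin n)} (hS : Tendsto S l (𝓝 T)) (hσ : Tendsto σ l (𝓝 σ₀))
    (hu : Tendsto u l (𝓝 u₀)) (hsymm : ∀ᶠ p in l, (S p).transpose = S p)
    (h : ∀ᶠ p in l, IsEigenDecomp (S p) (σ p) (u p)) (hT : T.rank = m) :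
    IsEigenDecomp T σ₀ u₀ := by
  have hσi : ∀ i, Tendsto (fun p => σ p i) l (𝓝 (σ₀ i)) := tendsto_pi_nhds.1 hσ
  have hui : ∀ i, Tendsto (fun p => u p i) l (𝓝 (u₀ i)) := tendsto_pi_nhds.1 hu
  have horth : Orthonormal ℝ u₀ := by
    rw [orthonormal_iff_ite]
    intro i j
    refine tendsto_nhds_unique ((hui i).inner (hui j)) ?_
    refine tendsto_const_nhds.congr' ?_
    filter_upwards [h] with p hp
    exact (orthonormal_iff_ite.1 hp.orthonormal i j).symm
  have hanti : Antitone σ₀ := fun i j hij =>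
    le_of_tendsto_of_tendsto (hσi j) (hσi i) (h.mono fun p hp => hp.antitone hij)
  have hTeq : T = specMat σ₀ u₀ := by
    have h1 : Tendsto (fun p => specMat (σ p) (u p)) l (𝓝 (specMat σ₀ u₀)) := by
      have hc : Continuous fun q : (Fin m → ℝ) × (Fin m → EuclideanSpace ℝ (Fin n)) =>
          specMat q.1 q.2 := by
        refine continuous_matrix fun a b => ?_
        simp only [specMat_apply]
        fun_prop
      exact (hc.tendsto (σ₀, u₀)).comp (hσ.prodMk_nhds hu)
    refine tendsto_nhds_unique hS (h1.congr' ?_)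
    filter_upwards [h, hsymm] with p hp hs
    exact (hp.eq_specMat hs).symm
  -- Constant rank enters here: an eigenvalue tending to `0` would make the rank of `T` less than
  -- `m`.
  have hpos : ∀ i, 0 < σ₀ i := by
    intro i
    have h0 : 0 ≤ σ₀ i := ge_of_tendsto (hσi i) (h.mono fun p hp => (hp.pos i).le)
    refine h0.lt_of_ne' fun hz => ?_
    have := rank_specMat_lt u₀ hz
    rw [← hTeq, hT] at this
    exact lt_irrefl _ this
  rw [hTeq]
  exact isEigenDecomp_specMat horth hpos hanti

theorem isQPSolution_of_tendsto {ι : Type*} {l : Filter ι} [l.NeBot] {a : Fin m → ℝ}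
    {σ φ : ι → Fin m → ℝ} {σ₀ φ₀ : Fin m → ℝ} (hσ : Tendsto σ l (𝓝 σ₀))
    (hφ : Tendsto φ l (𝓝 φ₀)) (h : ∀ᶠ p in l, IsQPSolution a (σ p) (φ p)) :
    IsQPSolution a σ₀ φ₀ := by
  have hφi : ∀ i, Tendsto (fun p => φ p i) l (𝓝 (φ₀ i)) := tendsto_pi_nhds.1 hφ
  refine ⟨⟨fun i j hij => le_of_tendsto_of_tendsto (hφi i) (hφi j)
      (h.mono fun p hp => hp.1.1 hij),
    fun i => ge_of_tendsto (hφi i) (h.mono fun p hp => hp.1.2 i)⟩, fun ψ h1 h2 => ?_⟩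
  have hc : Continuous fun q : (Fin m → ℝ) × (Fin m → ℝ) =>
      ∑ t, (a t * q.2 t ^ 2 - 2 * √(q.1 t) * q.2 t) := by fun_prop
  exact le_of_tendsto_of_tendsto ((hc.tendsto (σ₀, φ₀)).comp (hσ.prodMk_nhds hφ))
    ((hc.tendsto (σ₀, ψ)).comp (hσ.prodMk_nhds tendsto_const_nhds))
    (h.mono fun p hp => hp.2 ψ h1 h2)

/-- Eigendecompositions and solutions of the quadratic program, along matrices that converge, have
a limit point. -/
theorem exists_tendsto_of_ultrafilter {ι : Type*} {U : Ultrafilter ι}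
    {S : ι → Matrix (Fin n) (Fin n) ℝ} {T : Matrix (Fin n) (Fin n) ℝ} {a : Fin m → ℝ}
    (ha : ∀ t, 0 < a t) {σ φ : ι → Fin m → ℝ} {u : ι → Fin m → EuclideanSpace ℝ (Fin n)}
    (hS : Tendsto S U (𝓝 T)) (hsymm : ∀ᶠ p in U, (S p).transpose = S p)
    (h : ∀ᶠ p in U, IsEigenDecomp (S p) (σ p) (u p))
    (hqp : ∀ᶠ p in U, IsQPSolution a (σ p) (φ p)) :
    ∃ σ₀ u₀ φ₀, Tendsto σ U (𝓝 σ₀) ∧ Tendsto u U (𝓝 u₀) ∧ Tendsto φ U (𝓝 φ₀) := by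
  set b := T.trace + 1 with hb
  have htr : ∀ᶠ p in U, (S p).trace < b :=
    ((Continuous.matrix_trace continuous_id).tendsto T |>.comp hS).eventually_lt_const
      (lt_add_one _)
  -- Positive eigenvalues are bounded by the trace, which converges.
  have hσle : ∀ᶠ p in U, ∀ i, 0 < σ p i ∧ σ p i ≤ b := by
    filter_upwards [htr, hsymm, h] with p h1 h2 h3 i
    refine ⟨h3.pos i, ?_⟩
    rw [h3.eq_specMat h2, trace_specMat h3.orthonormal] at h1
    exact (Finset.single_le_sum (fun j _ => (h3.pos j).le) (Finset.mem_univ i)).trans h1.le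
  have lim : ∀ {E : Type _} [TopologicalSpace E] {C : Set E} {f : ι → E}, IsCompact C →
      (∀ᶠ p in U, f p ∈ C) → ∃ x, Tendsto f U (𝓝 x) := by
    intro E _ C f hC hf
    obtain ⟨x, -, hx⟩ := hC.ultrafilter_le_nhds (U.map f) (le_principal_iff.2 hf)
    exact ⟨x, hx⟩
  obtain ⟨σ₀, hσ₀⟩ := lim (isCompact_Icc (a := (0 : Fin m → ℝ)) (b := fun _ => b))
    (hσle.mono fun p hp => ⟨fun i => (hp i).1.le, fun i => (hp i).2⟩)
  obtain ⟨u₀, hu₀⟩ := lim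
    (isCompact_closedBall (0 : Fin m → EuclideanSpace ℝ (Fin n)) 1) (f := u) (by
      filter_upwards [h] with p hp
      rw [mem_closedBall_zero_iff, pi_norm_le_iff_of_nonneg zero_le_one]
      exact fun i => (hp.orthonormal.1 i).le)
  obtain ⟨φ₀, hφ₀⟩ := lim (isCompact_Icc (a := (0 : Fin m → ℝ))
    (b := fun t => √(4 * (∑ i, b / a i) / a t))) (f := φ) (by
      filter_upwards [hσle, hqp] with p h1 h2
      refine ⟨fun i => h2.1.2 i, fun t => Real.le_sqrt_of_sq_le ?_⟩
      rw [le_div_iff₀ (ha t), mul_comm]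
      refine (h2.mul_sq_le ha (fun i => (h1 i).1.le) t).trans ?_
      gcongr with i
      · exact (ha i).le
      · exact (h1 i).2)
  exact ⟨σ₀, u₀, φ₀, hσ₀, hu₀, hφ₀⟩

variable {K : ℕ} {P : Measure (EuclideanSpace ℝ (Fin n))} [IsProbabilityMeasure P]

/-- No continuity of `D` is available. Every ultrafilter finer than the given one has limiting data
that are again admissible for the true variance, and all such data give the same optimal cost. -/
theorem tendsto_cost_scheme (hP : MemLp id 2 P) (hvar : varMatrix P ≠ 0) {ℓ : Fin K → ℝ}
    (hℓ : ∀ i, 0 < ℓ i) (hanti : Antitone ℓ)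
    {D : EuclideanSpace ℝ (Fin n) → Matrix (Fin n) (Fin n) ℝ → Fin K → EuclideanSpace ℝ (Fin n)}
    (hD : ∀ x S, S.PosSemidef → S ≠ 0 → IsAlgorithmOutput ℓ S (D x S)) :
    Tendsto (fun p : EuclideanSpace ℝ (Fin n) × Matrix (Fin n) (Fin n) ℝ =>
        cost P (scheme p.1 (D p.1 p.2)))
      (𝓝[{p | p.2.PosSemidef ∧ p.2.rank = (varMatrix P).rank}] (mean P, varMatrix P))
      (𝓝 (cost P (scheme (mean P) (D (mean P) (varMatrix P))))) := by
  obtain ⟨h0, hm, σ₁, u₁, φ₁, heig₁, hqp₁, hD₁, -⟩ :=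
    (hD (mean P) _ (varMatrix_posSemidef hP) hvar).spec hvar
  rw [cost_scheme_mean hP heig₁ hqp₁ hD₁]
  set m := (varMatrix P).rank with hmdef
  set s : Set (EuclideanSpace ℝ (Fin n) × Matrix (Fin n) (Fin n) ℝ) :=
    {p | p.2.PosSemidef ∧ p.2.rank = m}
  have hdata : ∀ p : EuclideanSpace ℝ (Fin n) × Matrix (Fin n) (Fin n) ℝ,
      ∃ (σ : Fin m → ℝ) (u : Fin m → EuclideanSpace ℝ (Fin n)) (φ : Fin m → ℝ), p ∈ s →
        IsEigenDecomp p.2 σ u ∧ IsQPSolution (lumped hm ℓ) σ φ ∧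
        dictMatrix (D p.1 p.2) * (dictMatrix (D p.1 p.2)).transpose =
          specMat (fun t => √(σ t) / φ t) u := by
    intro p
    by_cases hp : p ∈ s
    · have hp0 : p.2 ≠ 0 := by
        intro hz
        have := hp.2
        rw [hz, Matrix.rank_zero] at this
        omega
      obtain ⟨-, hm', σ, u, φ, h1, h2, h3, -⟩ := (hD p.1 p.2 hp.1 hp0).spec hp0
      have hr : p.2.rank = m := hp.2
      generalize hk : p.2.rank = k at *
      subst hr
      exact ⟨σ, u, φ, fun _ => ⟨h1, h2, h3⟩⟩
    · exact ⟨0, 0, 0, fun h => absurd h hp⟩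
  choose σ u φ hdata using hdata
  rw [tendsto_iff_ultrafilter]
  intro U hU
  have hs : ∀ᶠ p in U, p ∈ s := hU self_mem_nhdsWithin
  have hnhds : (U : Filter _) ≤ 𝓝 (mean P, varMatrix P) := hU.trans nhdsWithin_le_nhds
  have hS : Tendsto (fun p : EuclideanSpace ℝ (Fin n) × Matrix (Fin n) (Fin n) ℝ => p.2) U
      (𝓝 (varMatrix P)) := (continuous_snd.tendsto _).mono_left hnhds
  have hx : Tendsto (fun p : EuclideanSpace ℝ (Fin n) × Matrix (Fin n) (Fin n) ℝ => p.1) U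
      (𝓝 (mean P)) := (continuous_fst.tendsto _).mono_left hnhds
  have hsymm : ∀ᶠ p : EuclideanSpace ℝ (Fin n) × Matrix (Fin n) (Fin n) ℝ in U,
      p.2.transpose = p.2 := hs.mono fun p hp => by
    simpa [Matrix.IsHermitian] using hp.1.isHermitian
  have heig : ∀ᶠ p : EuclideanSpace ℝ (Fin n) × Matrix (Fin n) (Fin n) ℝ in U,
      IsEigenDecomp p.2 (σ p) (u p) := hs.mono fun p hp => (hdata p hp).1
  have hqp : ∀ᶠ p in U, IsQPSolution (lumped hm ℓ) (σ p) (φ p) :=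
    hs.mono fun p hp => (hdata p hp).2.1
  obtain ⟨σ₀, u₀, φ₀, hσ₀, hu₀, hφ₀⟩ :=
    exists_tendsto_of_ultrafilter (lumped_pos hm hℓ) hS hsymm heig hqp
  have heig₀ := isEigenDecomp_of_tendsto hS hσ₀ hu₀ hsymm heig rfl
  have hqp₀ := isQPSolution_of_tendsto hσ₀ hφ₀ hqp
  have hlim : Tendsto (fun p => ∑ i, φ p i / √(σ p i) *
      (quad (varMatrix P) (u p i) + inner ℝ (u p i) (mean P - p.1) ^ 2)) U
      (𝓝 (∑ i, φ₀ i / √(σ₀ i) *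
        (quad (varMatrix P) (u₀ i) + inner ℝ (u₀ i) (mean P - mean P) ^ 2))) := by
    have hquad : Continuous (quad (varMatrix P)) :=
      continuous_id.inner (LinearMap.continuous_of_finiteDimensional _)
    refine tendsto_finsetSum _ fun i _ => ?_
    have h1 := tendsto_pi_nhds.1 hσ₀ i
    have h2 := tendsto_pi_nhds.1 hu₀ i
    have h3 := tendsto_pi_nhds.1 hφ₀ i
    exact (h3.div h1.sqrt (Real.sqrt_pos.2 (heig₀.pos i)).ne').mul
      (((hquad.tendsto _).comp h2).add ((h2.inner (tendsto_const_nhds.sub hx)).pow 2))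
  -- The limiting data may differ from the data chosen at the true variance; only their common
  -- optimal value matters.
  rw [sum_sqrt_mul_eq hP hm h0 hℓ hanti heig₁ hqp₁ heig₀ hqp₀]
  have hval : ∑ i, φ₀ i / √(σ₀ i) *
      (quad (varMatrix P) (u₀ i) + inner ℝ (u₀ i) (mean P - mean P) ^ 2) =
      ∑ i, √(σ₀ i) * φ₀ i := by
    refine Finset.sum_congr rfl fun i _ => ?_
    have h2 := Real.mul_self_sqrt (heig₀.pos i).le
    have h3 := (Real.sqrt_pos.2 (heig₀.pos i)).ne'
    rw [heig₀.quad_eq, sub_self, inner_zero_right, zero_pow two_ne_zero, add_zero]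
    nth_rw 2 [← h2]
    field_simp
  rw [← hval]
  refine ((ENNReal.continuous_ofReal.tendsto _).comp hlim).congr' ?_
  filter_upwards [hs] with p hp
  obtain ⟨h1, h2, h3⟩ := hdata p hp
  rw [cost_scheme hP h1.orthonormal (fun t =>
    div_pos (Real.sqrt_pos.2 (h1.pos t)) (h2.pos h1.pos t)) h3]
  simp only [Function.comp_apply, inv_div]

end Limit

end L2Dict

theorem mainTheorem5 {n K : ℕ} (hnK : n ≤ K)
    (P : Measure (EuclideanSpace ℝ (Fin n))) [IsProbabilityMeasure P] (hP : MemLp id 2 P)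
    (hvar : L2Dict.varMatrix P ≠ 0)
    (ℓ : Fin K → ℝ) (hℓ_pos : ∀ i, 0 < ℓ i) (hℓ_anti : Antitone ℓ) :
    (∀ S : Matrix (Fin n) (Fin n) ℝ, S.PosSemidef → S ≠ 0 →
      ∃ d, L2Dict.IsAlgorithmOutput ℓ S d) ∧
    ∀ D : EuclideanSpace ℝ (Fin n) → Matrix (Fin n) (Fin n) ℝ →
        Fin K → EuclideanSpace ℝ (Fin n),
      (∀ μ' S, S.PosSemidef → S ≠ 0 → L2Dict.IsAlgorithmOutput ℓ S (D μ' S)) →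
      Tendsto
        (fun p : EuclideanSpace ℝ (Fin n) × Matrix (Fin n) (Fin n) ℝ =>
          L2Dict.cost P (L2Dict.scheme p.1 (D p.1 p.2)))
        (𝓝[{p | p.2.PosSemidef ∧ p.2.rank = (L2Dict.varMatrix P).rank}]
          (L2Dict.mean P, L2Dict.varMatrix P))
        (𝓝 (L2Dict.cost P (L2Dict.scheme (L2Dict.mean P)
          (D (L2Dict.mean P) (L2Dict.varMatrix P))))) ∧
      L2Dict.cost P (L2Dict.scheme (L2Dict.mean P)
        (D (L2Dict.mean P) (L2Dict.varMatrix P))) ≠ ⊤ ∧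
      L2Dict.IsOptimal P ℓ (L2Dict.mean P) (D (L2Dict.mean P) (L2Dict.varMatrix P))
        (L2Dict.scheme (L2Dict.mean P) (D (L2Dict.mean P) (L2Dict.varMatrix P))) := by
  refine ⟨fun S hS hS0 => L2Dict.exists_isAlgorithmOutput hnK hℓ_pos hℓ_anti hS hS0,
    fun D hD => ?_⟩
  obtain ⟨h0, hm, σ, u, φ, heig, hqp, hDD, hlen⟩ :=
    (hD (L2Dict.mean P) _ (L2Dict.varMatrix_posSemidef hP) hvar).spec hvar
  refine ⟨L2Dict.tendsto_cost_scheme hP hvar hℓ_pos hℓ_anti hD, ?_,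
    L2Dict.isOptimal_scheme hP hm h0 heig hqp hDD hlen⟩
  rw [L2Dict.cost_scheme_mean hP heig hqp hDD]
  exact ENNReal.ofReal_ne_top
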